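/- Let $R$ be a commutative Noetherian local ring that is complete with respect to its maximal ideal, let $\Lambda$ be an associative unital $R$-algebra that is finitely generated as an $R$-module, and let $\mathfrak{a}$ be a proper ideal of $R$ such that $\operatorname{Tor}_n^R(\Lambda, R/\mathfrak{a}) = 0$ for all $n > 0$. Assume that $R$ is normally flat along $\mathfrak{a}$, that is, $\mathfrak{a}^n/\mathfrak{a}^{n+1}$ is a flat $R/\mathfrak{a}$-module for every $n > 0$. Then for every finitely generated right $\Lambda/\mathfrak{a}\Lambda$-module $N$ with $\operatorname{Ext}^2_{\Lambda/\mathfrak{a}\Lambda}(N,N) = 0$ there is a finitely generated right $\Lambda$-module $M$ such that $M \otimes_\Lambda \Lambda/\mathfrak{a}\Lambda \cong N$ as right $\Lambda/\mathfrak{a}\Lambda$-modules and $\operatorname{Tor}_n^{\Lambda}(M, \Lambda/\mathfrak{a}\Lambda) = 0$ for all $n > 0$. -/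

import Mathlib

open CategoryTheory CategoryTheory.Limits MulOpposite
open scoped TensorProduct

universe u

noncomputable section

namespace AbelianLift

/-! Throughout, a right module over a (noncommutative) ring `Λ` is a module over `Λᵐᵒᵖ`, so that
`m * a` is written `op a • m`. -/

section Tensor

variable (Λ Γ B : Type u) [Ring Λ] [Ring Γ] [AddCommGroup B] [Module Λ B] [Module Γᵐᵒᵖ B]
  [SMulCommClass Λ Γᵐᵒᵖ B]

/-- The relations `m * a ⊗ b = m ⊗ a * b` defining `M ⊗_Λ B`, for a right `Λ`-module `M` and a
`Λ`-`Γ`-bimodule `B`. The two factors are written in the order `b ⊗ m`, since Mathlib lets the right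
action of `Γ` act on the left factor of a tensor product of abelian groups. -/
def balancedRel (M : Type u) [AddCommGroup M] [Module Λᵐᵒᵖ M] : Submodule Γᵐᵒᵖ (B ⊗[ℤ] M) :=
  Submodule.span Γᵐᵒᵖ
    {t | ∃ (a : Λ) (b : B) (m : M), t = (a • b) ⊗ₜ[ℤ] m - b ⊗ₜ[ℤ] (op a • m)}

/-- The tensor product `M ⊗_Λ B` of a right `Λ`-module `M` and a `Λ`-`Γ`-bimodule `B`, with its
structure of right `Γ`-module. -/
abbrev BalancedTensor (M : Type u) [AddCommGroup M] [Module Λᵐᵒᵖ M] : Type u :=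
  (B ⊗[ℤ] M) ⧸ balancedRel Λ Γ B M

variable {M M' : Type u} [AddCommGroup M] [Module Λᵐᵒᵖ M] [AddCommGroup M'] [Module Λᵐᵒᵖ M']

/-- The map `b ⊗ m ↦ b ⊗ f m`, before passing to the quotient. -/
def preMap (f : M →ₗ[Λᵐᵒᵖ] M') : B ⊗[ℤ] M →ₗ[Γᵐᵒᵖ] B ⊗[ℤ] M' where
  toFun := TensorProduct.map LinearMap.id f.toAddMonoidHom.toIntLinearMap
  map_add' := map_add _
  map_smul' g t := by
    induction t using TensorProduct.induction_on with
    | zero => simp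
    | tmul b m => simp [TensorProduct.smul_tmul']
    | add x y hx hy => simp only [smul_add, map_add, hx, hy]

/-- The map `f ⊗_Λ B : M ⊗_Λ B → M' ⊗_Λ B` induced by `f : M → M'`. -/
def balancedMap (f : M →ₗ[Λᵐᵒᵖ] M') :
    BalancedTensor Λ Γ B M →ₗ[Γᵐᵒᵖ] BalancedTensor Λ Γ B M' :=
  Submodule.mapQ _ _ (preMap Λ Γ B f) <| by
    rw [balancedRel, Submodule.span_le]
    rintro _ ⟨a, b, m, rfl⟩
    refine Submodule.subset_span ⟨a, b, f m, ?_⟩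
    rw [map_sub, ← map_smul]
    rfl

variable {Λ Γ B} in
theorem balanced_ext {P : Type u} [AddCommGroup P] [Module Γᵐᵒᵖ P]
    {f g : BalancedTensor Λ Γ B M →ₗ[Γᵐᵒᵖ] P}
    (h : ∀ (b : B) (m : M), f (Submodule.Quotient.mk (b ⊗ₜ[ℤ] m)) =
      g (Submodule.Quotient.mk (b ⊗ₜ[ℤ] m))) : f = g := by
  refine LinearMap.ext fun x => ?_
  obtain ⟨t, rfl⟩ := Submodule.Quotient.mk_surjective _ x
  induction t using TensorProduct.induction_on with
  | zero => simp
  | tmul b m => exact h b m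
  | add x y hx hy => rw [Submodule.Quotient.mk_add, map_add, map_add, hx, hy]

/-- The functor `- ⊗_Λ B` from right `Λ`-modules to right `Γ`-modules given by a
`Λ`-`Γ`-bimodule `B`. -/
def tensorFunctor : ModuleCat.{u} Λᵐᵒᵖ ⥤ ModuleCat.{u} Γᵐᵒᵖ where
  obj M := ModuleCat.of Γᵐᵒᵖ (BalancedTensor Λ Γ B M)
  map f := ModuleCat.ofHom (balancedMap Λ Γ B f.hom)
  map_id M := by
    apply ModuleCat.hom_ext
    exact balanced_ext fun b m => rfl
  map_comp f g := by
    apply ModuleCat.hom_ext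
    exact balanced_ext fun b m => rfl

instance : (tensorFunctor Λ Γ B).Additive where
  map_add {X Y f g} := by
    apply ModuleCat.hom_ext
    refine balanced_ext fun b m => ?_
    change (Submodule.Quotient.mk (b ⊗ₜ[ℤ] (f.hom m + g.hom m)) : BalancedTensor Λ Γ B Y) =
      Submodule.Quotient.mk (b ⊗ₜ[ℤ] f.hom m) + Submodule.Quotient.mk (b ⊗ₜ[ℤ] g.hom m)
    rw [TensorProduct.tmul_add, Submodule.Quotient.mk_add]

/-- `Tor_n^Λ(-, B)`: the `n`-th left derived functor of `- ⊗_Λ B`. -/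
def torFunctor (n : ℕ) : ModuleCat.{u} Λᵐᵒᵖ ⥤ ModuleCat.{u} Γᵐᵒᵖ :=
  (tensorFunctor Λ Γ B).leftDerived n

end Tensor

section Algebra

variable {R : Type u} [CommRing R] (𝔞 : Ideal R) (Λ : Type u) [Ring Λ] [Algebra R Λ]

/-- The ideal `𝔞Λ` of `Λ` generated by the image of `𝔞`. -/
abbrev extendedIdeal : Ideal Λ := 𝔞.map (algebraMap R Λ)

/-- As the image of `R` in `Λ` is central, `𝔞Λ` is a two-sided ideal. -/
instance : (extendedIdeal 𝔞 Λ).IsTwoSided where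
  mul_mem_of_left {x} y hx := by
    induction hx using Submodule.span_induction with
    | mem x hx =>
      obtain ⟨r, hr, rfl⟩ := hx
      rw [Algebra.commutes]
      exact Ideal.mul_mem_left _ _ (Ideal.mem_map_of_mem _ hr)
    | zero => rw [zero_mul]; exact Ideal.zero_mem _
    | add x z _ _ hx hz => rw [add_mul]; exact Ideal.add_mem _ hx hz
    | smul c x _ hx => rw [smul_eq_mul, mul_assoc]; exact Ideal.mul_mem_left _ _ hx

/-- The quotient ring `Λ / 𝔞Λ`. -/
abbrev QuotAlgebra : Type u := Λ ⧸ extendedIdeal 𝔞 Λ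

/-- The left action of `Λ` and the right action of `Λ / 𝔞Λ` on `Λ / 𝔞Λ` commute. -/
instance : SMulCommClass Λ (QuotAlgebra 𝔞 Λ)ᵐᵒᵖ (QuotAlgebra 𝔞 Λ) where
  smul_comm a c x := by
    obtain ⟨x, rfl⟩ := Ideal.Quotient.mk_surjective x
    obtain ⟨c, rfl⟩ := MulOpposite.op_surjective c
    obtain ⟨c, rfl⟩ := Ideal.Quotient.mk_surjective c
    change Ideal.Quotient.mk _ (a * (x * c)) = Ideal.Quotient.mk _ (a * x * c)
    rw [mul_assoc]

/-- A right `Λ / 𝔞Λ`-module `N` lifts to the right `Λ`-module `M` if `M ⊗_Λ Λ / 𝔞Λ ≅ N` as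
`Λ / 𝔞Λ`-modules and `Tor_n^Λ(M, Λ / 𝔞Λ) = 0` for all `n > 0`. -/
def LiftsTo (N : ModuleCat.{u} (QuotAlgebra 𝔞 Λ)ᵐᵒᵖ) (M : ModuleCat.{u} Λᵐᵒᵖ) : Prop :=
  Nonempty ((tensorFunctor Λ (QuotAlgebra 𝔞 Λ) (QuotAlgebra 𝔞 Λ)).obj M ≅ N) ∧
    ∀ n : ℕ, 0 < n → IsZero ((torFunctor Λ (QuotAlgebra 𝔞 Λ) (QuotAlgebra 𝔞 Λ) n).obj M)

/-- `R` is normally flat along `𝔞` if the `R / 𝔞`-module `𝔞 ^ n / 𝔞 ^ (n + 1)` is flat for all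
`n > 0`. Here `𝔞 ^ (n + 1)` is the submodule `𝔞 • ⊤` of the module `𝔞 ^ n`. -/
def IsNormallyFlat : Prop :=
  ∀ n : ℕ, 0 < n →
    Module.Flat (R ⧸ 𝔞) (↥(𝔞 ^ n) ⧸ (𝔞 • ⊤ : Submodule R ↥(𝔞 ^ n)))

/-- The submodule `𝔞 • ⊤` of `𝔞 ^ n` is `𝔞 ^ (n + 1)`. -/
theorem map_subtype_smul_top (n : ℕ) :
    (𝔞 • ⊤ : Submodule R ↥(𝔞 ^ n)).map (Submodule.subtype (𝔞 ^ n)) = 𝔞 ^ (n + 1) := by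
  rw [Submodule.map_smul'', Submodule.map_top, Submodule.range_subtype, smul_eq_mul, pow_succ']

end Algebra

end AbelianLift

end

/-! Right `Λ`-modules are modules over `A = Λᵐᵒᵖ`. Over the local ring `R / 𝔞`, normal flatness
makes each `𝔞 ^ n / 𝔞 ^ (n + 1)` free. Vanishing of `Tor₁(Λ, R / 𝔞)` carries this over to `A`: the
quotient `𝔞 ^ n A / 𝔞 ^ (n + 1) A` is a direct sum of copies of `A / 𝔞 A`, along generators `r j` of
`𝔞 ^ n` (`hasGradedBasis_of_injective`).

Take maps `d` between finite free `A`-modules whose reductions resolve `N`, and deform them into a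
complex order by order. If `D D` vanishes modulo `𝔞 ^ n`, write `D D = ∑ r j • Ω j`. Comparing the
two bracketings of `D D D` shows that each `Ω j` is a chain map of degree `-2` modulo `𝔞`. Its class
lies in `Ext²(N, N) = 0`, so `Ω j = d E j + E j d` (`exists_homotopy`), and `D - ∑ r j • E j`
squares to zero modulo `𝔞 ^ (n + 1)` (`exists_improvement`).

Completeness of `R` gives a limit with `D D = 0` (`exists_complex`). The graded pieces of this
complex are sums of copies of its reduction, which is exact in positive degrees, so the complex is
exact there as well (`exact_of_exact_mod`). It therefore resolves the cokernel `M` of `D 0`, and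
reducing this resolution gives both `M ⊗ Λ / 𝔞Λ ≅ N` and the vanishing of Tor. -/

namespace AbelianLift

/-! ### Submodules `I M` and maps out of finite free modules. -/

section Adic

variable {R A H H' : Type*} [CommRing R] [Ring A] [Algebra R A]
  [AddCommGroup H] [Module R H] [Module A H] [IsScalarTower R A H]
  [AddCommGroup H'] [Module R H'] [Module A H'] [IsScalarTower R A H']

theorem smul_mem_smul_top (I : Ideal R) (a : A) {x : H} (hx : x ∈ (I • ⊤ : Submodule R H)) :
    a • x ∈ (I • ⊤ : Submodule R H) := by
  have : SMulCommClass R A H := IsScalarTower.to_smulCommClass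
  induction hx using Submodule.smul_induction_on' with
  | smul r hr h _ =>
    rw [← smul_comm]
    exact Submodule.smul_mem_smul hr trivial
  | add x _ y _ hx hy => rw [smul_add]; exact Submodule.add_mem _ hx hy

theorem map_mem_smul_top (I : Ideal R) (f : H →ₗ[A] H') {x : H}
    (hx : x ∈ (I • ⊤ : Submodule R H)) : f x ∈ (I • ⊤ : Submodule R H') := by
  induction hx using Submodule.smul_induction_on' with
  | smul r hr h _ =>
    rw [LinearMap.map_smul_of_tower]
    exact Submodule.smul_mem_smul hr trivial
  | add x _ y _ hx hy => rw [map_add]; exact Submodule.add_mem _ hx hy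

omit [Module A H] [IsScalarTower R A H] in
theorem smul_mem_mul_smul_top {I J : Ideal R} {r : R} (hr : r ∈ I) {x : H}
    (hx : x ∈ (J • ⊤ : Submodule R H)) : r • x ∈ ((I * J) • ⊤ : Submodule R H) := by
  rw [Submodule.mul_smul]
  exact Submodule.smul_mem_smul hr hx

omit [Module A H] [IsScalarTower R A H] in
theorem exists_eq_sum_of_mem_span_smul {k : ℕ} (x : Fin k → R) {y : H}
    (hy : y ∈ (Ideal.span (Set.range x) • ⊤ : Submodule R H)) :
    ∃ z : Fin k → H, y = ∑ j, x j • z j := by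
  induction hy using Submodule.smul_induction_on' with
  | smul r hr h _ =>
    obtain ⟨c, rfl⟩ := (Submodule.mem_span_range_iff_exists_fun R).1 hr
    exact ⟨fun j => c j • h, by simp [Finset.sum_smul, smul_smul, mul_comm]⟩
  | add y _ y' _ h h' =>
    obtain ⟨z, rfl⟩ := h
    obtain ⟨z', rfl⟩ := h'
    exact ⟨z + z', by simp [Finset.sum_add_distrib]⟩

theorem pi_map_mem_smul_top (I : Ideal R) {b : ℕ} (f : (Fin b → A) →ₗ[A] H)
    (h : ∀ i, f (Pi.single i 1) ∈ (I • ⊤ : Submodule R H)) (x : Fin b → A) :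
    f x ∈ (I • ⊤ : Submodule R H) := by
  have : x = ∑ i, x i • (Pi.single i 1 : Fin b → A) := by
    ext j
    simp [Finset.sum_apply, Pi.single_apply]
  rw [this, map_sum]
  refine Submodule.sum_mem _ fun i _ => ?_
  rw [map_smul]
  exact smul_mem_smul_top I _ (h i)

/-- Maps out of a finite free module lift along maps whose range contains theirs. -/
theorem exists_lift {b : ℕ} (P : (Fin b → A) →ₗ[A] H') (Q : H →ₗ[A] H')
    (h : ∀ x, ∃ y, P x = Q y) : ∃ E : (Fin b → A) →ₗ[A] H, ∀ x, P x = Q (E x) := by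
  choose y hy using h
  refine ⟨(Pi.basisFun A (Fin b)).constr ℕ fun i => y (Pi.single i 1), fun x => ?_⟩
  have : P = Q ∘ₗ (Pi.basisFun A (Fin b)).constr ℕ fun i => y (Pi.single i 1) := by
    refine (Pi.basisFun A (Fin b)).ext fun i => ?_
    rw [LinearMap.comp_apply, Module.Basis.constr_basis, Pi.basisFun_apply, hy]
  exact DFunLike.congr_fun this x

theorem mem_pi_smul_top_iff (I : Ideal R) {b : ℕ} (x : Fin b → H) :
    x ∈ (I • ⊤ : Submodule R (Fin b → H)) ↔ ∀ i, x i ∈ (I • ⊤ : Submodule R H) := by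
  constructor
  · intro hx i
    exact map_mem_smul_top I (LinearMap.proj (R := R) (φ := fun _ : Fin b => H) i) hx
  · intro hx
    have : x = ∑ i, LinearMap.single R (fun _ : Fin b => H) i (x i) := by
      ext j
      simp [Finset.sum_apply, Pi.single_apply]
    rw [this]
    exact Submodule.sum_mem _ fun i _ => map_mem_smul_top I _ (hx i)

/-- The graded pieces `𝔞 ^ n M / 𝔞 ^ (n + 1) M` are direct sums of copies of `M / 𝔞 M`, with
injections given by generators of `𝔞 ^ n`. -/
def HasGradedBasis (𝔞 : Ideal R) (M : Type*) [AddCommGroup M] [Module R M] : Prop :=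
  ∀ n : ℕ, ∃ (k : ℕ) (x : Fin k → R), Ideal.span (Set.range x) = 𝔞 ^ n ∧
    ∀ z : Fin k → M, ∑ j, x j • z j ∈ (𝔞 ^ (n + 1) • ⊤ : Submodule R M) →
      ∀ j, z j ∈ (𝔞 • ⊤ : Submodule R M)

theorem HasGradedBasis.pi {𝔞 : Ideal R} (h : HasGradedBasis 𝔞 H) (b : ℕ) :
    HasGradedBasis 𝔞 (Fin b → H) := by
  intro n
  obtain ⟨k, x, hx, hz⟩ := h n
  refine ⟨k, x, hx, fun z hmem j => ?_⟩
  rw [mem_pi_smul_top_iff] at hmem ⊢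
  intro i
  refine hz (fun j => z j i) ?_ j
  simpa [Finset.sum_apply] using hmem i

theorem HasGradedBasis.of_equiv {𝔞 : Ideal R} (h : HasGradedBasis 𝔞 H) (e : H ≃ₗ[R] H') :
    HasGradedBasis 𝔞 H' := by
  intro n
  obtain ⟨k, x, hx, hz⟩ := h n
  refine ⟨k, x, hx, fun z hmem j => ?_⟩
  have h1 := hz (fun j => e.symm (z j)) (by
    simpa using map_mem_smul_top _ e.symm.toLinearMap hmem) j
  simpa using map_mem_smul_top _ e.toLinearMap h1

end Adic

/-! ### Adic closedness and limits over a complete local ring. -/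

section Complete

variable {R H : Type*} [CommRing R] [IsNoetherianRing R] [IsLocalRing R]
  [AddCommGroup H] [Module R H] [Module.Finite R H]

/-- Krull's intersection theorem in `H ⧸ S`: submodules are `𝔞`-adically closed. -/
theorem mem_of_forall_exists_sub_mem {𝔞 : Ideal R} (h𝔞 : 𝔞 ≠ ⊤) (S : Submodule R H) {x : H}
    (h : ∀ n : ℕ, ∃ y ∈ S, x - y ∈ (𝔞 ^ n • ⊤ : Submodule R H)) : x ∈ S := by
  rw [← Submodule.Quotient.mk_eq_zero, ← Submodule.mem_bot R,
    ← Ideal.iInf_pow_smul_eq_bot_of_isLocalRing (M := H ⧸ S) 𝔞 h𝔞, Submodule.mem_iInf]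
  intro n
  obtain ⟨y, hy, hxy⟩ := h n
  have := map_mem_smul_top _ S.mkQ hxy
  rwa [map_sub, Submodule.mkQ_apply, Submodule.mkQ_apply, (Submodule.Quotient.mk_eq_zero S).2 hy,
    sub_zero] at this

/-- The limit exists in the topology of the maximal ideal. Each `𝔞 ^ n` is closed there, so `l - s
n`, being a limit of elements of `𝔞 ^ n`, lies in it. -/
theorem exists_limit_ring [IsAdicComplete (IsLocalRing.maximalIdeal R) R] {𝔞 : Ideal R}
    (h𝔞 : 𝔞 ≠ ⊤) (s : ℕ → R) (hs : ∀ n, s (n + 1) - s n ∈ 𝔞 ^ n) :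
    ∃ l, ∀ n, l - s n ∈ 𝔞 ^ n := by
  have hs' : ∀ m n, m ≤ n → s n - s m ∈ 𝔞 ^ m := by
    intro m n hmn
    induction n, hmn using Nat.le_induction with
    | base => simp
    | succ n hmn ih =>
      rw [← sub_add_sub_cancel]
      exact Ideal.add_mem _ (Ideal.pow_le_pow_right hmn (hs n)) ih
  have hle := IsLocalRing.le_maximalIdeal h𝔞
  obtain ⟨l, hl⟩ := IsPrecomplete.prec (I := IsLocalRing.maximalIdeal R) (M := R) inferInstance
    (f := s) (by
      intro m n hmn
      rw [SModEq.sub_mem, smul_eq_mul, Ideal.mul_top, ← neg_mem_iff, neg_sub]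
      exact Ideal.pow_right_mono hle m (hs' m n hmn))
  refine ⟨l, fun n => ?_⟩
  refine mem_of_forall_exists_sub_mem (𝔞 := IsLocalRing.maximalIdeal R)
    (Ideal.IsPrime.ne_top inferInstance) (𝔞 ^ n : Submodule R R) fun N => ?_
  refine ⟨s (max n N) - s n, hs' _ _ (le_max_left _ _), ?_⟩
  have h1 := hl (max n N)
  rw [SModEq.sub_mem, ← neg_mem_iff, neg_sub] at h1
  rw [sub_sub_sub_cancel_right]
  exact Submodule.smul_mono_left (Ideal.pow_le_pow_right (le_max_right _ _)) h1

theorem exists_limit [IsAdicComplete (IsLocalRing.maximalIdeal R) R] {𝔞 : Ideal R}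
    (h𝔞 : 𝔞 ≠ ⊤) (s : ℕ → H)
    (hs : ∀ n, s (n + 1) - s n ∈ (𝔞 ^ n • ⊤ : Submodule R H)) :
    ∃ l, ∀ n, l - s n ∈ (𝔞 ^ n • ⊤ : Submodule R H) := by
  obtain ⟨k, e, he⟩ := Module.Finite.exists_fin (R := R) (M := H)
  have h1 : ∀ n, ∃ c : Fin k → R, (∀ j, c j ∈ 𝔞 ^ n) ∧ s (n + 1) - s n = ∑ j, c j • e j := by
    intro n
    have h2 := hs n
    rw [← he, Submodule.mem_ideal_smul_span_iff_exists_sum] at h2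
    obtain ⟨c, hc, h2⟩ := h2
    refine ⟨c, hc, ?_⟩
    rw [← h2, Finsupp.sum_fintype _ _ (by simp)]
  choose c hc hsum using h1
  have h2 : ∀ j, ∃ l, ∀ n, l - ∑ i ∈ Finset.range n, c i j ∈ 𝔞 ^ n := fun j =>
    exists_limit_ring h𝔞 _ fun n => by
      rw [Finset.sum_range_succ, add_sub_cancel_left]
      exact hc n j
  choose l hl using h2
  refine ⟨s 0 + ∑ j, l j • e j, fun n => ?_⟩
  have h3 : s n = s 0 + ∑ j, (∑ i ∈ Finset.range n, c i j) • e j := by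
    induction n with
    | zero => simp
    | succ n ih =>
      rw [← sub_add_cancel (s (n + 1)) (s n), hsum, ih]
      simp only [Finset.sum_range_succ, add_smul, Finset.sum_add_distrib]
      abel
  rw [h3, add_sub_add_left_eq_sub, ← Finset.sum_sub_distrib]
  refine Submodule.sum_mem _ fun j _ => ?_
  rw [← sub_smul]
  exact Submodule.smul_mem_smul (hl j n) trivial

end Complete
-- From graded bases of `R` to graded bases of a module.
section IdealTensor

variable {R M : Type*} [CommRing R] [AddCommGroup M] [Module R M]

variable (M) in
/-- The multiplication map `I ⊗ M → M`. -/
noncomputable def idealTensorMap (I : Ideal R) : I ⊗[R] M →ₗ[R] M :=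
  TensorProduct.lift ((LinearMap.lsmul R M).comp I.subtype)

@[simp]
theorem idealTensorMap_tmul (I : Ideal R) (r : I) (m : M) :
    idealTensorMap M I (r ⊗ₜ m) = (r : R) • m := rfl

theorem exists_idealTensorMap_eq (I : Ideal R) {m : M} (hm : m ∈ (I • ⊤ : Submodule R M)) :
    ∃ t, idealTensorMap M I t = m := by
  induction hm using Submodule.smul_induction_on' with
  | smul r hr m _ => exact ⟨⟨r, hr⟩ ⊗ₜ m, rfl⟩
  | add x _ y _ hx hy =>
    obtain ⟨s, rfl⟩ := hx
    obtain ⟨t, rfl⟩ := hy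
    exact ⟨s + t, map_add _ _ _⟩

/-- Generators of `𝔞 ^ n` that form a basis of `𝔞 ^ n / 𝔞 ^ (n + 1)` over `R / 𝔞`, with the
coordinate functions. -/
structure GradedBasis (𝔞 : Ideal R) (n k : ℕ) where
  gen : Fin k → ↥(𝔞 ^ n)
  coord : Fin k → ↥(𝔞 ^ n) →ₗ[R] R ⧸ 𝔞
  span_gen : Ideal.span (Set.range fun j => (gen j : R)) = 𝔞 ^ n
  coord_gen : ∀ i j, coord i (gen j) = if i = j then 1 else 0
  coord_eq_zero : ∀ i (w : ↥(𝔞 ^ n)), (w : R) ∈ 𝔞 ^ (n + 1) → coord i w = 0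

variable {𝔞 : Ideal R} {n k : ℕ}

theorem GradedBasis.span_gen_eq_top (x : GradedBasis 𝔞 n k) :
    Submodule.span R (Set.range x.gen) = ⊤ := by
  apply Submodule.map_injective_of_injective (Submodule.subtype_injective (𝔞 ^ n))
  rw [Submodule.map_span, Submodule.map_top, Submodule.range_subtype, ← Set.range_comp]
  exact x.span_gen

theorem GradedBasis.mem_of_sum_eq_zero (x : GradedBasis 𝔞 n k) {r : Fin k → R}
    (h : ∑ j, r j • x.gen j = 0) (i : Fin k) : r i ∈ 𝔞 := by
  have := congrArg (x.coord i) h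
  simp only [map_sum, map_smul, x.coord_gen, map_zero] at this
  rw [← Ideal.Quotient.eq_zero_iff_mem, ← this]
  simp [Algebra.smul_def]

/-- By injectivity, `∑ x.gen j ⊗ z j` comes from `𝔞 ^ (n + 1) ⊗ M`, where the `i`-th coordinate
vanishes. Applying that coordinate gives `1 ⊗ z i = 0` in `R / 𝔞 ⊗ M = M / 𝔞 M`. -/
theorem GradedBasis.mem_smul_top (x : GradedBasis 𝔞 n k)
    (hinj : Function.Injective (idealTensorMap M (𝔞 ^ n))) (z : Fin k → M)
    (hz : ∑ j, (x.gen j : R) • z j ∈ (𝔞 ^ (n + 1) • ⊤ : Submodule R M)) (i : Fin k) :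
    z i ∈ (𝔞 • ⊤ : Submodule R M) := by
  obtain ⟨t, ht⟩ := exists_idealTensorMap_eq _ hz
  let ι : ↥(𝔞 ^ (n + 1)) →ₗ[R] ↥(𝔞 ^ n) := Submodule.inclusion (Ideal.pow_le_pow_right n.le_succ)
  have hι : idealTensorMap M (𝔞 ^ n) ∘ₗ ι.rTensor M = idealTensorMap M (𝔞 ^ (n + 1)) :=
    TensorProduct.ext' fun _ _ => rfl
  have h1 : ι.rTensor M t = ∑ j, x.gen j ⊗ₜ z j := by
    apply hinj
    rw [← LinearMap.comp_apply, hι, ht, map_sum]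
    rfl
  have h2 : (x.coord i).rTensor M ∘ₗ ι.rTensor M = 0 := by
    rw [← LinearMap.rTensor_comp]
    have : x.coord i ∘ₗ ι = 0 := LinearMap.ext fun w => x.coord_eq_zero i _ w.2
    rw [this, LinearMap.rTensor_zero]
  have h3 := congrArg ((x.coord i).rTensor M) h1
  rw [← LinearMap.comp_apply, h2, map_sum] at h3
  simp only [LinearMap.rTensor_tmul, x.coord_gen, LinearMap.zero_apply] at h3
  rw [Finset.sum_eq_single i (by intro b _ hb; simp [hb.symm]) (by simp), if_pos rfl] at h3
  have h4 := congrArg (TensorProduct.quotTensorEquivQuotSMul M 𝔞) h3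
  rw [← map_one (Ideal.Quotient.mk 𝔞), TensorProduct.quotTensorEquivQuotSMul_mk_tmul,
    one_smul, map_zero] at h4
  exact (Submodule.Quotient.mk_eq_zero _).1 h4.symm

theorem GradedBasis.injective_succ (x : GradedBasis 𝔞 n k)
    (hinj : Function.Injective (idealTensorMap M (𝔞 ^ n)))
    (hinj1 : Function.Injective (idealTensorMap M 𝔞)) :
    Function.Injective (idealTensorMap M (𝔞 ^ (n + 1))) := by
  rw [injective_iff_map_eq_zero]
  intro t ht
  let ι : ↥(𝔞 ^ (n + 1)) →ₗ[R] ↥(𝔞 ^ n) := Submodule.inclusion (Ideal.pow_le_pow_right n.le_succ)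
  have hι : idealTensorMap M (𝔞 ^ n) ∘ₗ ι.rTensor M = idealTensorMap M (𝔞 ^ (n + 1)) :=
    TensorProduct.ext' fun _ _ => rfl
  let μ (j : Fin k) : 𝔞 →ₗ[R] ↥(𝔞 ^ (n + 1)) :=
    LinearMap.codRestrict (𝔞 ^ (n + 1)) ((LinearMap.mulLeft R (x.gen j : R)).comp 𝔞.subtype)
      fun r => by
        rw [pow_succ]
        exact Ideal.mul_mem_mul (x.gen j).2 r.2
  have hμ (j : Fin k) (s : 𝔞 ⊗[R] M) :
      ι.rTensor M ((μ j).rTensor M s) = x.gen j ⊗ₜ idealTensorMap M 𝔞 s := by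
    induction s with
    | zero => simp
    | tmul r m =>
      rw [LinearMap.rTensor_tmul, LinearMap.rTensor_tmul, idealTensorMap_tmul,
        TensorProduct.tmul_smul, TensorProduct.smul_tmul']
      congr 1
      exact Subtype.ext (mul_comm _ _)
    | add s t hs ht => simp only [map_add, hs, ht, TensorProduct.tmul_add]
  have hsurj : ∃ s : Fin k → 𝔞 ⊗[R] M, t = ∑ j, (μ j).rTensor M (s j) := by
    clear ht
    induction t with
    | zero => exact ⟨0, by simp⟩
    | add t t' h h' =>
      obtain ⟨s, rfl⟩ := h
      obtain ⟨s', rfl⟩ := h'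
      exact ⟨s + s', by simp [Finset.sum_add_distrib]⟩
    | tmul w m =>
      obtain ⟨w, hw⟩ := w
      have hw' := hw
      rw [pow_succ', ← x.span_gen, ← smul_eq_mul, Ideal.span,
        Submodule.mem_ideal_smul_span_iff_exists_sum] at hw'
      obtain ⟨c, hc, hsum⟩ := hw'
      refine ⟨fun j => ⟨c j, hc j⟩ ⊗ₜ m, ?_⟩
      simp only [LinearMap.rTensor_tmul]
      rw [← TensorProduct.sum_tmul]
      congr 1
      apply Subtype.ext
      rw [AddSubmonoidClass.coe_finsetSum]
      change w = _
      rw [← hsum, Finsupp.sum_fintype _ _ (by simp)]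
      exact Finset.sum_congr rfl fun j _ => mul_comm _ _
  obtain ⟨s, rfl⟩ := hsurj
  have h1 : ∑ j, x.gen j ⊗ₜ[R] idealTensorMap M 𝔞 (s j) = 0 := by
    simp only [← hμ]
    rw [← map_sum]
    apply hinj
    rw [← LinearMap.comp_apply, hι, ht, map_zero]
  -- The equational criterion for a vanishing tensor turns `h1` into relations among the generators.
  -- Their coefficients `a` lie in `𝔞`, since the generators are independent modulo `𝔞`; so the `s
  -- j` can be rewritten through these relations, which makes the sum zero.
  obtain ⟨κ, a, y, hy, ha⟩ :=
    (TensorProduct.vanishesTrivially_iff_sum_tmul_eq_zero R x.span_gen_eq_top).2 h1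
  have ha' : ∀ i l, a i l ∈ 𝔞 := fun i l => x.mem_of_sum_eq_zero (ha l) i
  have h2 : ∀ j, s j = ∑ l, (⟨a j l, ha' j l⟩ : 𝔞) ⊗ₜ[R] y l := by
    intro j
    apply hinj1
    rw [map_sum]
    exact hy j
  simp only [h2, map_sum, LinearMap.rTensor_tmul]
  rw [Finset.sum_comm]
  refine Finset.sum_eq_zero fun l _ => ?_
  rw [← TensorProduct.sum_tmul]
  refine (congrArg (· ⊗ₜ[R] y l) (Subtype.ext ?_)).trans (TensorProduct.zero_tmul _ _)
  rw [AddSubmonoidClass.coe_finsetSum]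
  have := congrArg Subtype.val (ha l)
  rw [AddSubmonoidClass.coe_finsetSum] at this
  refine Eq.trans (Finset.sum_congr rfl fun j _ => ?_) this
  exact mul_comm _ _

theorem hasGradedBasis_of_injective (h : ∀ n, ∃ k, Nonempty (GradedBasis 𝔞 n k))
    (hinj : Function.Injective (idealTensorMap M 𝔞)) : HasGradedBasis 𝔞 M := by
  have h0 : Function.Injective (idealTensorMap M (𝔞 ^ 0)) := by
    rw [pow_zero, Ideal.one_eq_top]
    have : idealTensorMap M (⊤ : Ideal R) = (TensorProduct.congr Submodule.topEquiv
        (LinearEquiv.refl R M) ≪≫ₗ TensorProduct.lid R M).toLinearMap :=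
      TensorProduct.ext' fun _ _ => rfl
    rw [this]
    exact LinearEquiv.injective _
  have h1 : ∀ n, Function.Injective (idealTensorMap M (𝔞 ^ n)) := by
    intro n
    induction n with
    | zero => exact h0
    | succ n ih =>
      obtain ⟨k, ⟨x⟩⟩ := h n
      exact x.injective_succ ih hinj
  intro n
  obtain ⟨k, ⟨x⟩⟩ := h n
  exact ⟨k, _, x.span_gen, x.mem_smul_top (h1 n)⟩

end IdealTensor

/-! ### Graded bases from normal flatness. -/

section NormallyFlat

variable {R : Type*} [CommRing R] {𝔞 : Ideal R}

/-- Normal flatness speaks of positive exponents only; in degree zero the graded piece is `R / 𝔞`,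
with basis `1`. -/
theorem exists_gradedBasis_zero : Nonempty (GradedBasis 𝔞 0 1) := by
  refine ⟨⟨fun _ => ⟨1, by simp⟩, fun _ => 𝔞.mkQ ∘ₗ Submodule.subtype _, by simp, ?_, ?_⟩⟩
  · intro i j
    rw [Subsingleton.elim i j, if_pos rfl]
    rfl
  · intro i w hw
    rw [zero_add, pow_one] at hw
    exact (Submodule.Quotient.mk_eq_zero _).2 hw

/-- A finite flat module over the local ring `R / 𝔞` is free, and by Nakayama a lifted basis
generates `𝔞 ^ n`. -/
theorem exists_gradedBasis [IsNoetherianRing R] [IsLocalRing R] (h𝔞 : 𝔞 ≠ ⊤) (n : ℕ)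
    [Module.Flat (R ⧸ 𝔞) (↥(𝔞 ^ n) ⧸ (𝔞 • ⊤ : Submodule R ↥(𝔞 ^ n)))] :
    ∃ k, Nonempty (GradedBasis 𝔞 n k) := by
  have : Nontrivial (R ⧸ 𝔞) := Ideal.Quotient.nontrivial_iff.2 h𝔞
  have : IsLocalRing (R ⧸ 𝔞) :=
    IsLocalRing.of_surjective' (Ideal.Quotient.mk 𝔞) Ideal.Quotient.mk_surjective
  let V := ↥(𝔞 ^ n) ⧸ (𝔞 • ⊤ : Submodule R ↥(𝔞 ^ n))
  have : Module.Finite (R ⧸ 𝔞) V := Module.Finite.of_restrictScalars_finite R _ _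
  have : Module.Free (R ⧸ 𝔞) V := Module.free_of_flat_of_isLocalRing
  let e := Module.finBasis (R ⧸ 𝔞) V
  choose x hx using fun j => Submodule.Quotient.mk_surjective _ (e j)
  refine ⟨_, ⟨⟨x, fun i => (e.coord i).restrictScalars R ∘ₗ Submodule.mkQ _, ?_, ?_, ?_⟩⟩⟩
  · have h1 : (⊤ : Submodule R ↥(𝔞 ^ n)) ≤ Submodule.span R (Set.range x) := by
      refine Submodule.le_of_le_smul_of_le_jacobson_bot (I := 𝔞) (Module.finite_def.1 inferInstance)
        (by rw [IsLocalRing.jacobson_eq_maximalIdeal _ bot_ne_top]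
            exact IsLocalRing.le_maximalIdeal h𝔞) ?_
      intro w _
      obtain ⟨c, hc⟩ := (Submodule.mem_span_range_iff_exists_fun (R ⧸ 𝔞)).1
        (by rw [e.span_eq]; trivial : (Submodule.Quotient.mk w : V) ∈ _)
      choose r hr using fun j => Ideal.Quotient.mk_surjective (c j)
      refine Submodule.mem_sup.2 ⟨∑ j, r j • x j, ?_, w - ∑ j, r j • x j, ?_, by abel⟩
      · exact Submodule.sum_mem _ fun j _ => Submodule.smul_mem _ _
          (Submodule.subset_span ⟨j, rfl⟩)
      · rw [← Submodule.Quotient.mk_eq_zero, Submodule.Quotient.mk_sub, sub_eq_zero, ← hc,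
          ← Submodule.mkQ_apply, map_sum]
        refine Finset.sum_congr rfl fun j _ => ?_
        rw [map_smul, Submodule.mkQ_apply, hx, ← hr]
        rfl
    have h2 := congrArg (Submodule.map (Submodule.subtype (𝔞 ^ n))) (top_le_iff.1 h1)
    rw [Submodule.map_span, Submodule.map_top, Submodule.range_subtype, ← Set.range_comp] at h2
    exact h2
  · intro i j
    change e.coord i (Submodule.Quotient.mk (x j)) = _
    rw [hx, Module.Basis.coord_apply, Module.Basis.repr_self, Finsupp.single_apply]
    simp [eq_comm]
  · intro i w hw
    have : w ∈ (𝔞 • ⊤ : Submodule R ↥(𝔞 ^ n)) := by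
      rw [← map_subtype_smul_top] at hw
      obtain ⟨w', hw', h⟩ := hw
      rwa [← Subtype.ext h]
    change e.coord i (Submodule.Quotient.mk w) = 0
    rw [(Submodule.Quotient.mk_eq_zero _).2 this, map_zero]

end NormallyFlat

/-! ### Vanishing of `Tor₁` and injectivity of `𝔞 ⊗ M → M`. -/

section Tor

/-- The resolution of `R / 𝔞` is arbitrary, so `𝔞` is compared with the first syzygy: `κ` multiplies
a lift `p` of `1`, and `φ'` goes back. The composite is multiplication by `φ p`, which is a unit
because it is `1` modulo `𝔞`. Exactness after tensoring kills `κ t`, hence `t`. -/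
theorem idealTensorMap_injective_of_exact {R M P₀ P₁ P₂ : Type*} [CommRing R] [IsLocalRing R]
    [AddCommGroup M] [Module R M] [AddCommGroup P₀] [Module R P₀] [AddCommGroup P₁] [Module R P₁]
    [AddCommGroup P₂] [Module R P₂] [Module.Projective R P₀] {𝔞 : Ideal R} (h𝔞 : 𝔞 ≠ ⊤)
    (d₂ : P₂ →ₗ[R] P₁) (d₁ : P₁ →ₗ[R] P₀) (π : P₀ →ₗ[R] R ⧸ 𝔞) (hπ : Function.Surjective π)
    (h₀ : Function.Exact d₁ π) (h₁ : d₁ ∘ₗ d₂ = 0)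
    (hM : Function.Exact (d₂.rTensor M) (d₁.rTensor M)) :
    Function.Injective (idealTensorMap M 𝔞) := by
  rw [injective_iff_map_eq_zero]
  intro t ht
  obtain ⟨p, hp⟩ := hπ (Ideal.Quotient.mk 𝔞 1)
  obtain ⟨φ, hφ⟩ := Module.projective_lifting_property 𝔞.mkQ π (Submodule.mkQ_surjective _)
  let κ : 𝔞 →ₗ[R] LinearMap.range d₁ :=
    LinearMap.codRestrict _ ((LinearMap.toSpanSingleton R P₀ p).comp 𝔞.subtype) fun r => by
      refine (h₀ _).1 ?_
      change π ((r : R) • p) = 0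
      rw [map_smul, hp, Algebra.smul_def, map_one, mul_one]
      exact Ideal.Quotient.eq_zero_iff_mem.2 r.2
  let φ' : LinearMap.range d₁ →ₗ[R] 𝔞 :=
    LinearMap.codRestrict 𝔞 (φ.comp (Submodule.subtype _)) fun q => by
      refine (Submodule.Quotient.mk_eq_zero 𝔞).1 ?_
      exact (DFunLike.congr_fun hφ (q : P₀)).trans ((h₀ _).2 q.2)
  have h2 : κ.rTensor M t = 0 := by
    obtain ⟨s, hs⟩ := LinearMap.rTensor_surjective M d₁.surjective_rangeRestrict (κ.rTensor M t)
    have h3 : d₁.rTensor M s = p ⊗ₜ idealTensorMap M 𝔞 t := by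
      have : d₁ = (Submodule.subtype _).comp d₁.rangeRestrict := rfl
      rw [this, LinearMap.rTensor_comp, LinearMap.comp_apply, hs]
      clear hs s ht
      induction t with
      | zero => simp
      | add s t hs ht => simp only [map_add, hs, ht, TensorProduct.tmul_add]
      | tmul r m =>
        rw [idealTensorMap_tmul, TensorProduct.tmul_smul, TensorProduct.smul_tmul']
        rfl
    rw [ht, TensorProduct.tmul_zero] at h3
    obtain ⟨s', rfl⟩ := (hM _).1 h3
    rw [← hs, ← LinearMap.comp_apply, ← LinearMap.rTensor_comp]
    have : d₁.rangeRestrict ∘ₗ d₂ = 0 :=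
      LinearMap.ext fun x => Subtype.ext (DFunLike.congr_fun h₁ x)
    rw [this, LinearMap.rTensor_zero, LinearMap.zero_apply]
  have h3 : φ' ∘ₗ κ = φ p • LinearMap.id := by
    refine LinearMap.ext fun r => Subtype.ext ?_
    change φ ((r : R) • p) = φ p * r
    rw [map_smul, smul_eq_mul, mul_comm]
  have h4 : φ p • t = 0 := by
    have := congrArg (φ'.rTensor M) h2
    rw [← LinearMap.comp_apply, ← LinearMap.rTensor_comp, h3, map_zero] at this
    simpa using this
  have h5 : IsUnit (φ p) := by
    have h6 : 1 - φ p ∈ 𝔞 := by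
      rw [← Ideal.Quotient.eq_zero_iff_mem, map_sub, sub_eq_zero, ← hp]
      exact (DFunLike.congr_fun hφ p).symm
    have h7 := IsLocalRing.le_maximalIdeal h𝔞 h6
    by_contra h8
    exact (IsLocalRing.maximalIdeal R).ne_top_iff_one.1 (Ideal.IsPrime.ne_top inferInstance)
      (by simpa using Ideal.add_mem _ h7 ((IsLocalRing.mem_maximalIdeal _).2 h8))
  exact (h5.smul_eq_zero).1 h4

theorem idealTensorMap_injective_of_isZero_tor {R M : Type u} [CommRing R] [IsLocalRing R]
    [AddCommGroup M] [Module R M] {𝔞 : Ideal R} (h𝔞 : 𝔞 ≠ ⊤)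
    (hTor : IsZero (((Tor (ModuleCat.{u} R) 1).obj (ModuleCat.of R M)).obj
      (ModuleCat.of R (R ⧸ 𝔞)))) :
    Function.Injective (idealTensorMap M 𝔞) := by
  let P := projectiveResolution (ModuleCat.of R (R ⧸ 𝔞))
  have h1 := hTor.of_iso (P.isoLeftDerivedObj
    ((MonoidalCategory.tensoringLeft (ModuleCat.{u} R)).obj (ModuleCat.of R M)) 1).symm
  rw [HomologicalComplex.homologyFunctor_obj, ← HomologicalComplex.exactAt_iff_isZero_homology,
    HomologicalComplex.exactAt_iff' _ 2 1 0 (by simp) (by simp)] at h1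
  have h2 := (ShortComplex.ShortExact.moduleCat_exact_iff_function_exact _).1 h1
  have h3 := (ShortComplex.ShortExact.moduleCat_exact_iff_function_exact _).1 P.exact₀
  have : Module.Projective R (P.complex.X 0) := (IsProjective.iff_projective _).2 (P.projective 0)
  refine idealTensorMap_injective_of_exact h𝔞 (P.complex.d 2 1).hom (P.complex.d 1 0).hom
    (P.π.f 0).hom ?_ h3 ?_ ?_
  · exact (ModuleCat.epi_iff_surjective _).1 inferInstance
  · rw [← ModuleCat.hom_comp, HomologicalComplex.d_comp_d]
    rfl
  · rw [LinearMap.rTensor_exact_iff_lTensor_exact]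
    exact h2

end Tor
-- Free maps that resolve `N` modulo `I`.
section Resolution

variable {R A : Type*} [CommRing R] [Ring A] [Algebra R A]

/-- The preimage of `I H` under an `A`-linear map to `H`. -/
def modKer (I : Ideal R) {G H : Type*} [AddCommGroup G] [Module A G] [AddCommGroup H] [Module R H]
    [Module A H] [IsScalarTower R A H] (f : G →ₗ[A] H) : Submodule A G where
  carrier := {x | f x ∈ (I • ⊤ : Submodule R H)}
  add_mem' hx hy := by
    simp only [Set.mem_ofPred_eq, map_add] at *
    exact Submodule.add_mem _ hx hy
  zero_mem' := by simp
  smul_mem' a x hx := by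
    simp only [Set.mem_ofPred_eq, map_smul] at *
    exact smul_mem_smul_top I a hx

theorem exists_range_eq [IsNoetherianRing A] {G : Type*} [AddCommGroup G] [Module A G]
    [Module.Finite A G] (K : Submodule A G) :
    ∃ (b : ℕ) (f : (Fin b → A) →ₗ[A] G), LinearMap.range f = K := by
  obtain ⟨b, s, hs⟩ := Submodule.fg_iff_exists_fin_generating_family.1 (IsNoetherian.noetherian K)
  exact ⟨b, Fintype.linearCombination A s, by rw [Fintype.range_linearCombination, hs]⟩

variable (A) in
/-- A map between finite free modules. -/
structure FreeMap where
  src : ℕ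
  tgt : ℕ
  map : (Fin src → A) →ₗ[A] (Fin tgt → A)

/-- A map from a finite free module onto the preimage of `I H` under the given map to `H`. -/
noncomputable def FreeMap.next [IsNoetherianRing A] (I : Ideal R) (s : FreeMap A) : FreeMap A :=
  ⟨(exists_range_eq (modKer I s.map)).choose, s.src,
    (exists_range_eq (modKer I s.map)).choose_spec.choose⟩

theorem FreeMap.range_next [IsNoetherianRing A] (I : Ideal R) (s : FreeMap A) :
    LinearMap.range (s.next I).map = modKer I s.map :=
  (exists_range_eq (modKer I s.map)).choose_spec.choose_spec

/-- A sequence of maps between finite free modules that becomes, modulo `I`, a resolution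
of `N`. -/
theorem exists_resolution_mod [IsNoetherianRing A] (I : Ideal R) (N : Type*) [AddCommGroup N]
    [Module A N] [Module.Finite A N] :
    ∃ (b : ℕ → ℕ) (d : ∀ i, (Fin (b (i + 1)) → A) →ₗ[A] (Fin (b i) → A))
      (ε : (Fin (b 0) → A) →ₗ[A] N), Function.Surjective ε ∧
      (∀ x, ε x = 0 ↔ ∃ y, d 0 y = x) ∧
      ∀ i x, d i x ∈ (I • ⊤ : Submodule R (Fin (b i) → A)) ↔ ∃ y, d (i + 1) y = x := by
  obtain ⟨b₀, ε, hε⟩ := exists_range_eq (⊤ : Submodule A N)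
  obtain ⟨b₁, d₀, hd₀⟩ := exists_range_eq (LinearMap.ker ε)
  -- Each later map covers the full preimage of `I` times the free module, not just its kernel. Its
  -- range thus contains `I` times its target, and later lifts through it hold exactly rather than
  -- modulo `I`.
  let s : ℕ → FreeMap A := Nat.rec ⟨b₁, b₀, d₀⟩ fun _ t => t.next I
  refine ⟨fun i => (s i).tgt, fun i => (s i).map, ε, LinearMap.range_eq_top.1 hε, fun x => ?_,
    fun i x => ?_⟩
  · rw [← LinearMap.mem_ker, ← hd₀]
    rfl
  · change x ∈ modKer I (s i).map ↔ _
    rw [← FreeMap.range_next]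
    rfl

end Resolution

/-! ### Null-homotopies and the inductive lifting step. -/

section Homotopy

variable {R A : Type*} [CommRing R] [Ring A] [Algebra R A] {I : Ideal R}
  {N : Type*} [AddCommGroup N] [Module A N] {b : ℕ → ℕ}
  {d : ∀ i, (Fin (b (i + 1)) → A) →ₗ[A] (Fin (b i) → A)} {ε : (Fin (b 0) → A) →ₗ[A] N}

/-- A chain map of degree `-2` modulo `I` is null-homotopic if every `2`-cocycle with values in
`N` is a coboundary. -/
theorem exists_homotopy (hε : Function.Surjective ε) (hε₀ : ∀ x, ε x = 0 ↔ ∃ y, d 0 y = x)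
    (hεI : ∀ x ∈ (I • ⊤ : Submodule R (Fin (b 0) → A)), ε x = 0)
    (hd : ∀ i x, d i x ∈ (I • ⊤ : Submodule R (Fin (b i) → A)) ↔ ∃ y, d (i + 1) y = x)
    (hExt : ∀ f : (Fin (b 2) → A) →ₗ[A] N,
      (∀ x, d 1 x ∈ (I • ⊤ : Submodule R (Fin (b 1) → A)) → f x = 0) →
      ∃ g : (Fin (b 1) → A) →ₗ[A] N, ∀ x, g (d 1 x) = f x)
    (ω : ∀ i, (Fin (b (i + 2)) → A) →ₗ[A] (Fin (b i) → A))
    (hω : ∀ i x, d i (ω (i + 1) x) - ω i (d (i + 2) x) ∈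
      (I • ⊤ : Submodule R (Fin (b i) → A))) :
    ∃ E : ∀ i, (Fin (b (i + 1)) → A) →ₗ[A] (Fin (b i) → A),
      ∀ i x, ω i x = d i (E (i + 1) x) + E i (d (i + 1) x) := by
  have hbase : ∃ p : ((Fin (b 1) → A) →ₗ[A] (Fin (b 0) → A)) ×
      ((Fin (b 2) → A) →ₗ[A] (Fin (b 1) → A)),
      ∀ x, ω 0 x = d 0 (p.2 x) + p.1 (d 1 x) := by
    -- `ε ∘ ω 0` is a cocycle because `ω` commutes with `d` modulo `I` and `ε ∘ d 0 = 0`. `E₀` lifts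
    -- the bounding map `g` through `ε`; then `ω 0 - E₀ ∘ d 1` lands in the kernel of `ε`, the range
    -- of `d 0`.
    obtain ⟨g, hg⟩ := hExt (ε ∘ₗ ω 0) fun x hx => by
      obtain ⟨y, rfl⟩ := (hd 1 x).1 hx
      have := hεI _ (hω 0 y)
      rw [map_sub, (hε₀ _).2 ⟨_, rfl⟩, zero_sub, neg_eq_zero] at this
      exact this
    obtain ⟨E₀, hE₀⟩ := exists_lift g ε fun x => by
      obtain ⟨y, hy⟩ := hε (g x)
      exact ⟨y, hy.symm⟩
    obtain ⟨E₁, hE₁⟩ := exists_lift (ω 0 - E₀ ∘ₗ d 1) (d 0) fun x => by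
      obtain ⟨y, hy⟩ := (hε₀ (ω 0 x - E₀ (d 1 x))).1 (by
        rw [map_sub, ← hE₀, hg, LinearMap.comp_apply, sub_self])
      exact ⟨y, hy.symm⟩
    exact ⟨(E₀, E₁), fun x => by rw [← hE₁]; simp⟩
  -- No obstruction remains in higher degrees: `d i` sends `ω (i + 1) - E₁ ∘ d (i + 2)` into the
  -- multiples of `I`, so its values are in the range of `d (i + 1)`.
  have hnext : ∀ i (p : {p : ((Fin (b (i + 1)) → A) →ₗ[A] (Fin (b i) → A)) ×
      ((Fin (b (i + 2)) → A) →ₗ[A] (Fin (b (i + 1)) → A)) //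
      ∀ x, ω i x = d i (p.2 x) + p.1 (d (i + 1) x)}),
      ∃ E : (Fin (b (i + 3)) → A) →ₗ[A] (Fin (b (i + 2)) → A),
      ∀ x, ω (i + 1) x = d (i + 1) (E x) + p.1.2 (d (i + 2) x) := by
    rintro i ⟨⟨E₀, E₁⟩, hE⟩
    obtain ⟨E, hE'⟩ := exists_lift (ω (i + 1) - E₁ ∘ₗ d (i + 2)) (d (i + 1)) fun x => by
      obtain ⟨y, hy⟩ := (hd i (ω (i + 1) x - E₁ (d (i + 2) x))).1 (by
        have h1 := hω i x
        rw [hE] at h1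
        have h2 := map_mem_smul_top I E₀ ((hd (i + 1) (d (i + 2) x)).2 ⟨x, rfl⟩)
        have h3 := Submodule.add_mem _ h1 h2
        rw [map_sub]
        convert h3 using 1
        dsimp only
        abel)
      exact ⟨y, hy.symm⟩
    exact ⟨E, fun x => by rw [← hE']; simp⟩
  choose nx hnx using hnext
  -- The equation in degree `i` involves two consecutive homotopies, so the recursion carries pairs.
  let s : ∀ i, {p : ((Fin (b (i + 1)) → A) →ₗ[A] (Fin (b i) → A)) ×
      ((Fin (b (i + 2)) → A) →ₗ[A] (Fin (b (i + 1)) → A)) //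
      ∀ x, ω i x = d i (p.2 x) + p.1 (d (i + 1) x)} :=
    Nat.rec ⟨hbase.choose, hbase.choose_spec⟩ fun i p => ⟨(p.1.2, nx i p), hnx i p⟩
  exact ⟨fun i => (s i).1.1, fun i => (s i).2⟩

/-- One step of the lifting process: a complex modulo `I ^ n` is improved to a complex
modulo `I ^ (n + 1)`. -/
theorem exists_improvement (hA : HasGradedBasis I A)
    (hH : ∀ ω : ∀ i, (Fin (b (i + 2)) → A) →ₗ[A] (Fin (b i) → A),
      (∀ i x, d i (ω (i + 1) x) - ω i (d (i + 2) x) ∈ (I • ⊤ : Submodule R (Fin (b i) → A))) →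
      ∃ E : ∀ i, (Fin (b (i + 1)) → A) →ₗ[A] (Fin (b i) → A),
        ∀ i x, ω i x = d i (E (i + 1) x) + E i (d (i + 1) x))
    {n : ℕ} (hn : n ≠ 0) (D : ∀ i, (Fin (b (i + 1)) → A) →ₗ[A] (Fin (b i) → A))
    (hDd : ∀ i x, D i x - d i x ∈ (I • ⊤ : Submodule R (Fin (b i) → A)))
    (hD : ∀ i x, D i (D (i + 1) x) ∈ (I ^ n • ⊤ : Submodule R (Fin (b i) → A))) :
    ∃ D' : ∀ i, (Fin (b (i + 1)) → A) →ₗ[A] (Fin (b i) → A),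
      (∀ i x, D' i x - D i x ∈ (I ^ n • ⊤ : Submodule R (Fin (b i) → A))) ∧
      ∀ i x, D' i (D' (i + 1) x) ∈ (I ^ (n + 1) • ⊤ : Submodule R (Fin (b i) → A)) := by
  obtain ⟨k, r, hr, hr'⟩ := hA n
  have hrn : ∀ j, r j ∈ I ^ n := fun j => hr ▸ Ideal.subset_span ⟨j, rfl⟩
  have hlift : ∀ i, ∃ Ω : (Fin (b (i + 2)) → A) →ₗ[A] (Fin k → Fin (b i) → A),
      ∀ x, D i (D (i + 1) x) = ∑ j, r j • Ω x j := by
    intro i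
    obtain ⟨Ω, hΩ⟩ := exists_lift (D i ∘ₗ D (i + 1))
      (∑ j, r j • (LinearMap.proj j : (Fin k → Fin (b i) → A) →ₗ[A] (Fin (b i) → A)))
      fun x => by
        obtain ⟨z, hz⟩ := exists_eq_sum_of_mem_span_smul r (hr.symm ▸ hD i x)
        exact ⟨z, by simpa using hz⟩
    exact ⟨Ω, fun x => by simpa using hΩ x⟩
  choose Ω hΩ using hlift
  have hstar : ∀ (i : ℕ) (z : Fin k → Fin (b i) → A), ∑ j, r j • z j = 0 →
      ∀ j, z j ∈ (I • ⊤ : Submodule R (Fin (b i) → A)) := by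
    intro i z hz j
    rw [mem_pi_smul_top_iff]
    refine fun l => hr' (fun j => z j l) ?_ j
    have h1 := congrFun hz l
    simp only [Finset.sum_apply, Pi.smul_apply, Pi.zero_apply] at h1
    rw [h1]
    exact Submodule.zero_mem _
  have hE : ∀ j, ∃ E : ∀ i, (Fin (b (i + 1)) → A) →ₗ[A] (Fin (b i) → A),
      ∀ i x, Ω i x j = d i (E (i + 1) x) + E i (d (i + 1) x) := by
    intro j
    refine hH (fun i => LinearMap.proj j ∘ₗ Ω i) fun i x => ?_
    -- Expanding both bracketings of `D D D` along `r` gives a vanishing combination, whose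
    -- coefficients must lie in `I`.
    have h1 := hstar i (fun j => D i (Ω (i + 1) x j) - Ω i (D (i + 2) x) j) (by
      simp only [smul_sub, Finset.sum_sub_distrib]
      have h0 := congrArg (D i) (hΩ (i + 1) x)
      rw [map_sum] at h0
      simp only [LinearMap.map_smul_of_tower] at h0
      rw [← hΩ, sub_eq_zero]
      exact h0.symm) j
    have h2 := hDd i (Ω (i + 1) x j)
    have h3 := map_mem_smul_top I (LinearMap.proj j ∘ₗ Ω i) (hDd (i + 2) x)
    have h4 := Submodule.add_mem _ (Submodule.sub_mem _ h1 h2) h3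
    convert h4 using 1
    simp only [LinearMap.comp_apply, LinearMap.proj_apply, map_sub]
    abel
  choose E hE using hE
  have hsum : ∀ i x, ∑ j, r j • E j i x ∈ (I ^ n • ⊤ : Submodule R (Fin (b i) → A)) := fun i x =>
    Submodule.sum_mem _ fun j _ => Submodule.smul_mem_smul (hrn j) trivial
  refine ⟨fun i => D i - ∑ j, r j • E j i, fun i x => ?_, fun i x => ?_⟩
  · rw [← neg_mem_iff]
    simpa using hsum i x
  -- With `D'` the corrected map, `D' D' = ∑ r j • ((d - D) E j + E j (d - D'))`. Both terms vanish
  -- modulo `I`; for the second, `n ≠ 0` gives `I ^ n ≤ I`.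
  · have h1 : ∀ j, d i (E j (i + 1) x) - D i (E j (i + 1) x) +
        E j i (d (i + 1) x - D (i + 1) x + ∑ l, r l • E l (i + 1) x) ∈
        (I • ⊤ : Submodule R (Fin (b i) → A)) := by
      intro j
      refine Submodule.add_mem _ ?_ (map_mem_smul_top I _ (Submodule.add_mem _ ?_ ?_))
      · rw [← neg_mem_iff, neg_sub]
        exact hDd _ _
      · rw [← neg_mem_iff, neg_sub]
        exact hDd _ _
      · exact Submodule.smul_mono_left (Ideal.pow_le_self hn) (hsum (i + 1) x)
    have h2 : ∑ j, r j • (d i (E j (i + 1) x) - D i (E j (i + 1) x) +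
        E j i (d (i + 1) x - D (i + 1) x + ∑ l, r l • E l (i + 1) x)) ∈
        (I ^ (n + 1) • ⊤ : Submodule R (Fin (b i) → A)) := by
      rw [pow_succ]
      exact Submodule.sum_mem _ fun j _ => smul_mem_mul_smul_top (hrn j) (h1 j)
    have h3 : ∑ l, ∑ j, r j • r l • E j i (E l (i + 1) x) =
        ∑ j, ∑ l, r j • r l • E j i (E l (i + 1) x) := Finset.sum_comm
    convert h2 using 1
    simp only [LinearMap.sub_apply, LinearMap.sum_apply, LinearMap.smul_apply, map_sub, hΩ, hE,
      map_add, map_sum, smul_add, smul_sub, Finset.sum_add_distrib, Finset.sum_sub_distrib,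
      LinearMap.map_smul_of_tower, Finset.smul_sum, h3]
    abel

end Homotopy
-- Cocycles and `Ext²` by dimension shifting.
section Ext

theorem exists_descent {C X Y Z : Type*} [Ring C] [AddCommGroup X] [Module C X] [AddCommGroup Y]
    [Module C Y] [AddCommGroup Z] [Module C Z] (q : X →ₗ[C] Y) (hq : Function.Surjective q)
    (f : X →ₗ[C] Z) (h : ∀ x, q x = 0 → f x = 0) : ∃ g : Y →ₗ[C] Z, ∀ x, g (q x) = f x := by
  refine ⟨(LinearMap.ker q).liftQ f h ∘ₗ (q.quotKerEquivOfSurjective hq).symm.toLinearMap,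
    fun x => ?_⟩
  have : (q.quotKerEquivOfSurjective hq).symm (q x) = Submodule.Quotient.mk x := by
    rw [LinearEquiv.symm_apply_eq]
    rfl
  change (LinearMap.ker q).liftQ f h ((q.quotKerEquivOfSurjective hq).symm (q x)) = f x
  rw [this]
  rfl

theorem shortExact_ker {C X Y : Type u} [Ring C] [AddCommGroup X] [Module C X]
    [AddCommGroup Y] [Module C Y] (q : X →ₗ[C] Y) (hq : Function.Surjective q) :
    (ShortComplex.mk (ModuleCat.ofHom (LinearMap.ker q).subtype) (ModuleCat.ofHom q)
      (by ext x; exact x.2)).ShortExact where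
  exact := by
    rw [ShortComplex.moduleCat_exact_iff]
    intro x hx
    exact ⟨⟨x, hx⟩, rfl⟩
  mono_f := (ModuleCat.mono_iff_injective _).2 Subtype.val_injective
  epi_g := (ModuleCat.epi_iff_surjective _).2 hq

/-- If `Ext² N N = 0`, then a `2`-cocycle on a projective resolution of `N` with values in `N`
is a coboundary. -/
theorem exists_coboundary {C F₀ F₁ F₂ : Type u} [Ring C] [AddCommGroup F₀] [Module C F₀]
    [AddCommGroup F₁] [Module C F₁] [AddCommGroup F₂] [Module C F₂] [Module.Projective C F₀]
    (N : ModuleCat.{u} C) (hExt : Subsingleton (Abelian.Ext.{u} N N 2))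
    (ε : F₀ →ₗ[C] N) (hε : Function.Surjective ε) (d₀ : F₁ →ₗ[C] F₀)
    (h₀ : ∀ x, ε x = 0 ↔ ∃ y, d₀ y = x) (d₁ : F₂ →ₗ[C] F₁) (h₁ : ∀ x, d₀ x = 0 ↔ ∃ y, d₁ y = x)
    (f : F₂ →ₗ[C] N) (hf : ∀ x, d₁ x = 0 → f x = 0) :
    ∃ g : F₁ →ₗ[C] N, ∀ x, g (d₁ x) = f x := by
  let d₀' : F₁ →ₗ[C] LinearMap.ker ε := d₀.codRestrict _ fun x => (h₀ _).2 ⟨x, rfl⟩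
  have hd₀' : Function.Surjective d₀' := by
    rintro ⟨x, hx⟩
    obtain ⟨y, hy⟩ := (h₀ _).1 hx
    exact ⟨y, Subtype.ext hy⟩
  have hker : ∀ x, d₀' x = 0 ↔ d₀ x = 0 := fun x => Subtype.ext_iff
  let d₁' : F₂ →ₗ[C] LinearMap.ker d₀' :=
    d₁.codRestrict _ fun x => (hker _).2 ((h₁ _).2 ⟨x, rfl⟩)
  have hd₁' : Function.Surjective d₁' := by
    rintro ⟨x, hx⟩
    obtain ⟨y, hy⟩ := (h₁ _).1 ((hker _).1 hx)
    exact ⟨y, Subtype.ext hy⟩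
  obtain ⟨fb, hfb⟩ := exists_descent d₁' hd₁' f fun x hx => hf x (congrArg Subtype.val hx)
  have S₀ := shortExact_ker ε hε
  have S₁ := shortExact_ker d₀' hd₀'
  have hP : Projective (ModuleCat.of C F₀) := (IsProjective.iff_projective _).1 inferInstance
  let φ : ModuleCat.of C (LinearMap.ker d₀') ⟶ N := ModuleCat.ofHom fb
  -- `y` is the obstruction to extending `φ` to `F₁`. Its product with the class of `S₀` lies in
  -- `Ext²(N, N) = 0`, and that product is injective on `Ext¹` because `F₀` is projective.
  let y := S₁.extClass.comp (Abelian.Ext.mk₀ φ) (add_zero 1)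
  have hy : y = 0 := by
    obtain ⟨x₂, hx₂⟩ := Abelian.Ext.contravariant_sequence_exact₁ S₀ N y (by rfl : 1 + 1 = 2)
      (Subsingleton.elim (α := Abelian.Ext.{u} N N 2) _ _)
    rw [← hx₂, Abelian.Ext.eq_zero_of_projective x₂, Abelian.Ext.comp_zero]
  obtain ⟨x₂, hx₂⟩ := Abelian.Ext.contravariant_sequence_exact₁ S₁ N (Abelian.Ext.mk₀ φ)
    (add_zero 1) hy
  obtain ⟨g, rfl⟩ := (Abelian.Ext.mk₀_bijective _ _).2 x₂
  rw [Abelian.Ext.mk₀_comp_mk₀] at hx₂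
  have h := (Abelian.Ext.mk₀_bijective _ _).1 hx₂
  refine ⟨g.hom, fun x => ?_⟩
  rw [← hfb]
  exact congrArg (fun t => t.hom (d₁' x)) h

end Ext

/-! ### Transfer between free `A`-modules and their reductions. -/

section BaseChange

variable {R A C : Type*} [CommRing R] [Ring A] [Algebra R A] [Ring C] {π : A →+* C} {I : Ideal R}

/-- The coordinatewise reduction `A ^ b → C ^ b`. -/
def piRed (π : A →+* C) (b : ℕ) : (Fin b → A) →ₛₗ[π] (Fin b → C) where
  toFun x i := π (x i)
  map_add' x y := by ext; simp
  map_smul' a x := by ext; simp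

theorem piRed_surjective (hπ : Function.Surjective π) (b : ℕ) :
    Function.Surjective (piRed π b) := fun y => by
  choose x hx using fun i => hπ (y i)
  exact ⟨x, funext hx⟩

theorem piRed_eq_zero_iff (hπI : ∀ a, π a = 0 ↔ a ∈ (I • ⊤ : Submodule R A)) {b : ℕ}
    (x : Fin b → A) : piRed π b x = 0 ↔ x ∈ (I • ⊤ : Submodule R (Fin b → A)) := by
  rw [mem_pi_smul_top_iff, funext_iff]
  exact forall_congr' fun i => hπI (x i)

theorem exists_piRed_comp {b : ℕ} {Y : Type*} [AddCommGroup Y] [Module C Y]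
    (g : (Fin b → A) →ₛₗ[π] Y) : ∃ f : (Fin b → C) →ₗ[C] Y, ∀ x, f (piRed π b x) = g x := by
  refine ⟨Fintype.linearCombination C fun i => g (Pi.single i 1), fun x => ?_⟩
  have hx : x = ∑ i, x i • (Pi.single i 1 : Fin b → A) := by
    ext j
    simp [Finset.sum_apply, Pi.single_apply]
  rw [Fintype.linearCombination_apply]
  conv_rhs => rw [hx, map_sum]
  exact Finset.sum_congr rfl fun i _ => (g.map_smulₛₗ _ _).symm

/-- `exists_coboundary` for a sequence of free `A`-modules that is a resolution modulo `I`. -/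
theorem exists_coboundary_mod {R A C : Type u} [CommRing R] [Ring A] [Algebra R A] [Ring C]
    {π : A →+* C} {I : Ideal R} (hπ : Function.Surjective π)
    (hπI : ∀ a, π a = 0 ↔ a ∈ (I • ⊤ : Submodule R A))
    (N : ModuleCat.{u} C) (hExt : Subsingleton (Abelian.Ext.{u} N N 2)) {b : ℕ → ℕ}
    (d : ∀ i, (Fin (b (i + 1)) → A) →ₗ[A] (Fin (b i) → A)) (ε : (Fin (b 0) → A) →ₛₗ[π] N)
    (hε : Function.Surjective ε) (hε₀ : ∀ x, ε x = 0 ↔ ∃ y, d 0 y = x)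
    (hd : ∀ i x, d i x ∈ (I • ⊤ : Submodule R (Fin (b i) → A)) ↔ ∃ y, d (i + 1) y = x)
    (f : (Fin (b 2) → A) →ₛₗ[π] N)
    (hf : ∀ x, d 1 x ∈ (I • ⊤ : Submodule R (Fin (b 1) → A)) → f x = 0) :
    ∃ g : (Fin (b 1) → A) →ₛₗ[π] N, ∀ x, g (d 1 x) = f x := by
  obtain ⟨f', hf'⟩ := exists_piRed_comp f
  obtain ⟨ε', hε'⟩ := exists_piRed_comp ε
  choose d' hd' using fun i => exists_piRed_comp ((piRed π (b i)).comp (d i))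
  have hred : ∀ {i} x, x ∈ (I • ⊤ : Submodule R (Fin (b i) → A)) ↔ piRed π (b i) x = 0 :=
    fun x => (piRed_eq_zero_iff hπI x).symm
  obtain ⟨g, hg⟩ := exists_coboundary N hExt ε' (fun n => by
      obtain ⟨x, rfl⟩ := hε n
      exact ⟨_, hε' x⟩) (d' 0) (fun x => by
      obtain ⟨x, rfl⟩ := piRed_surjective hπ _ x
      rw [hε', hε₀]
      constructor
      · rintro ⟨y, rfl⟩
        exact ⟨_, hd' 0 y⟩
      · rintro ⟨y, hy⟩
        obtain ⟨y, rfl⟩ := piRed_surjective hπ _ y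
        rw [← hε₀, ← hε', ← hy, hd']
        exact (hε' _).trans ((hε₀ _).2 ⟨y, rfl⟩)) (d' 1) (fun x => by
      obtain ⟨x, rfl⟩ := piRed_surjective hπ _ x
      rw [hd']
      change piRed π _ (d 0 x) = 0 ↔ _
      rw [← hred, hd]
      constructor
      · rintro ⟨y, rfl⟩
        exact ⟨_, hd' 1 y⟩
      · rintro ⟨y, hy⟩
        obtain ⟨y, rfl⟩ := piRed_surjective hπ _ y
        rw [← hd, hred]
        refine (hd' 0 x).symm.trans ?_
        rw [← hy, hd']
        refine (hd' 0 (d 1 y)).trans ((hred _).1 ((hd _ _).2 ⟨y, rfl⟩))) f' (fun x hx => by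
      obtain ⟨x, rfl⟩ := piRed_surjective hπ _ x
      rw [hf']
      rw [hd'] at hx
      exact hf x ((hred _).2 hx))
  refine ⟨g.comp (piRed π _), fun x => ?_⟩
  rw [← hf', ← hg, hd']
  rfl

end BaseChange
-- The limit complex and its exactness.
section Limit

variable {R A : Type*} [CommRing R] [IsNoetherianRing R] [IsLocalRing R]
  [IsAdicComplete (IsLocalRing.maximalIdeal R) R] [Ring A] [Algebra R A] [Module.Finite R A]
  {I : Ideal R}

theorem exists_limit_map (hI : I ≠ ⊤) {b c : ℕ} (D : ℕ → (Fin b → A) →ₗ[A] (Fin c → A))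
    (hD : ∀ n x, D (n + 1) x - D n x ∈ (I ^ n • ⊤ : Submodule R (Fin c → A))) :
    ∃ L : (Fin b → A) →ₗ[A] (Fin c → A),
      ∀ n x, L x - D n x ∈ (I ^ n • ⊤ : Submodule R (Fin c → A)) := by
  choose l hl using fun i : Fin b =>
    exists_limit hI (fun n => D n (Pi.single i 1)) fun n => hD n _
  refine ⟨(Pi.basisFun A (Fin b)).constr ℕ l, fun n x => ?_⟩
  refine pi_map_mem_smul_top (I ^ n) ((Pi.basisFun A (Fin b)).constr ℕ l - D n) (fun i => ?_) x
  have := (Pi.basisFun A (Fin b)).constr_basis ℕ l i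
  rw [Pi.basisFun_apply] at this
  rw [LinearMap.sub_apply, this]
  exact hl i n

variable {b : ℕ → ℕ} {d : ∀ i, (Fin (b (i + 1)) → A) →ₗ[A] (Fin (b i) → A)}

/-- A sequence of maps that is a complex modulo `I` lifts to a complex, if complexes modulo
`I ^ n` can be improved. -/
theorem exists_complex (hI : I ≠ ⊤)
    (hd : ∀ i x, d i (d (i + 1) x) ∈ (I • ⊤ : Submodule R (Fin (b i) → A)))
    (himp : ∀ {n : ℕ}, n ≠ 0 → ∀ D : ∀ i, (Fin (b (i + 1)) → A) →ₗ[A] (Fin (b i) → A),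
      (∀ i x, D i x - d i x ∈ (I • ⊤ : Submodule R (Fin (b i) → A))) →
      (∀ i x, D i (D (i + 1) x) ∈ (I ^ n • ⊤ : Submodule R (Fin (b i) → A))) →
      ∃ D' : ∀ i, (Fin (b (i + 1)) → A) →ₗ[A] (Fin (b i) → A),
        (∀ i x, D' i x - D i x ∈ (I ^ n • ⊤ : Submodule R (Fin (b i) → A))) ∧
        ∀ i x, D' i (D' (i + 1) x) ∈ (I ^ (n + 1) • ⊤ : Submodule R (Fin (b i) → A))) :
    ∃ D : ∀ i, (Fin (b (i + 1)) → A) →ₗ[A] (Fin (b i) → A),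
      (∀ i x, D i x - d i x ∈ (I • ⊤ : Submodule R (Fin (b i) → A))) ∧
      ∀ i x, D i (D (i + 1) x) = 0 := by
  -- Index `n` stands for a complex modulo `I ^ (n + 1)`: the recursion starts at `d`, and `himp`
  -- meets only nonzero exponents.
  let T (n : ℕ) := {D : ∀ i, (Fin (b (i + 1)) → A) →ₗ[A] (Fin (b i) → A) //
    (∀ i x, D i x - d i x ∈ (I • ⊤ : Submodule R (Fin (b i) → A))) ∧
    ∀ i x, D i (D (i + 1) x) ∈ (I ^ (n + 1) • ⊤ : Submodule R (Fin (b i) → A))}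
  have hnext : ∀ n (D : T n), ∃ D' : T (n + 1),
      ∀ i x, D'.1 i x - D.1 i x ∈ (I ^ (n + 1) • ⊤ : Submodule R (Fin (b i) → A)) := by
    rintro n ⟨D, hD, hDD⟩
    obtain ⟨D', hD', hDD'⟩ := himp n.succ_ne_zero D hD hDD
    refine ⟨⟨D', fun i x => ?_, hDD'⟩, hD'⟩
    rw [← sub_add_sub_cancel]
    exact Submodule.add_mem _ (Submodule.smul_mono_left (Ideal.pow_le_self n.succ_ne_zero)
      (hD' i x)) (hD i x)
  choose nx hnx using hnext
  let s : ∀ n, T n := Nat.rec ⟨d, fun i x => by simp, fun i x => by simpa using hd i x⟩ nx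
  have hs : ∀ n i x, (s (n + 1)).1 i x - (s n).1 i x ∈
      (I ^ (n + 1) • ⊤ : Submodule R (Fin (b i) → A)) := fun n => hnx n (s n)
  choose L hL using fun i => exists_limit_map hI (fun n => (s n).1 i) fun n x =>
    Submodule.smul_mono_left (Ideal.pow_le_pow_right n.le_succ) (hs n i x)
  refine ⟨L, fun i x => ?_, fun i x => ?_⟩
  · rw [← sub_add_sub_cancel _ ((s 1).1 i x)]
    refine Submodule.add_mem _ ?_ ((s 1).2.1 i x)
    simpa using hL i 1 x
  · rw [← Submodule.mem_bot R]
    refine mem_of_forall_exists_sub_mem hI ⊥ fun n => ⟨0, Submodule.zero_mem _, ?_⟩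
    have h1 := hL i n (L (i + 1) x)
    have h2 := map_mem_smul_top (I ^ n) ((s n).1 i) (hL (i + 1) n x)
    have h3 := Submodule.smul_mono_left (N := (⊤ : Submodule R (Fin (b i) → A)))
      (Ideal.pow_le_pow_right n.le_succ) ((s n).2.2 i x)
    have h4 := Submodule.add_mem _ (Submodule.add_mem _ h1 h2) h3
    rw [map_sub] at h4
    convert h4 using 1
    abel

omit [IsAdicComplete (IsLocalRing.maximalIdeal R) R] in
/-- A complex of finite free modules that is exact modulo `I` is exact. -/
theorem exact_of_exact_mod (hI : I ≠ ⊤) (hA : HasGradedBasis I A)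
    {D : ∀ i, (Fin (b (i + 1)) → A) →ₗ[A] (Fin (b i) → A)} (hDD : ∀ i x, D i (D (i + 1) x) = 0)
    (hD : ∀ i x, D i x ∈ (I • ⊤ : Submodule R (Fin (b i) → A)) →
      ∃ y, x - D (i + 1) y ∈ (I • ⊤ : Submodule R (Fin (b (i + 1)) → A)))
    (i : ℕ) (x : Fin (b (i + 1)) → A) (hx : D i x = 0) : ∃ y, D (i + 1) y = x := by
  refine mem_of_forall_exists_sub_mem hI ((LinearMap.range (D (i + 1))).restrictScalars R)
    fun n => ?_
  induction n with
  | zero => exact ⟨0, Submodule.zero_mem _, by simp⟩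
  | succ n ih =>
    obtain ⟨_, ⟨y, rfl⟩, hy⟩ := ih
    obtain ⟨k, r, hr, hz⟩ := (hA.pi (b i)) n
    rw [← hr] at hy
    obtain ⟨z, hyz⟩ := exists_eq_sum_of_mem_span_smul r hy
    have h1 := congrArg (D i) hyz
    rw [map_sub, hx, hDD, sub_zero, map_sum] at h1
    simp only [LinearMap.map_smul_of_tower] at h1
    -- The error `∑ r j • z j` is a cycle, so each `D i (z j)` vanishes modulo `I` and `z j` is a
    -- boundary modulo `I`. Adding `∑ r j • w j` to `y` gains one order.
    choose w hw using fun j => hD i (z j) (hz _ (by rw [← h1]; exact Submodule.zero_mem _) j)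
    refine ⟨D (i + 1) (y + ∑ j, r j • w j), ⟨_, rfl⟩, ?_⟩
    have h2 : x - D (i + 1) (y + ∑ j, r j • w j) = ∑ j, r j • (z j - D (i + 1) (w j)) := by
      rw [map_add, ← sub_sub, hyz, map_sum]
      simp only [LinearMap.map_smul_of_tower, smul_sub, Finset.sum_sub_distrib]
    rw [h2, pow_succ]
    exact Submodule.sum_mem _ fun j _ =>
      smul_mem_mul_smul_top (hr ▸ Ideal.subset_span ⟨j, rfl⟩) (hw j)

end Limit

/-- `N` becomes an `A`-module through `π`. The limit maps agree with the initial ones modulo `I`,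
which transfers exactness modulo `I` and the description of the kernel of `ε`. -/
theorem exists_resolution_lift {R A C : Type u} [CommRing R] [IsNoetherianRing R] [IsLocalRing R]
    [IsAdicComplete (IsLocalRing.maximalIdeal R) R] [Ring A] [Algebra R A] [Module.Finite R A]
    [Ring C] {I : Ideal R} (hI : I ≠ ⊤) (hA : HasGradedBasis I A) {π : A →+* C}
    (hπ : Function.Surjective π) (hπI : ∀ a, π a = 0 ↔ a ∈ (I • ⊤ : Submodule R A))
    (N : ModuleCat.{u} C) [Module.Finite C N] (hExt : Subsingleton (Abelian.Ext.{u} N N 2)) :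
    ∃ (b : ℕ → ℕ) (D : ∀ i, (Fin (b (i + 1)) → A) →ₗ[A] (Fin (b i) → A))
      (ε : (Fin (b 0) → A) →ₛₗ[π] N), Function.Surjective ε ∧
      (∀ x, ε x = 0 ↔ ∃ y, x - D 0 y ∈ (I • ⊤ : Submodule R (Fin (b 0) → A))) ∧
      (∀ i x, D i (D (i + 1) x) = 0) ∧ (∀ i x, D i x = 0 → ∃ y, D (i + 1) y = x) ∧
      ∀ i x, D i x ∈ (I • ⊤ : Submodule R (Fin (b i) → A)) →
        ∃ y, x - D (i + 1) y ∈ (I • ⊤ : Submodule R (Fin (b (i + 1)) → A)) := by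
  let _ : Module A N := Module.compHom N π
  have hsmul : ∀ (a : A) (n : N), a • n = π a • n := fun _ _ => rfl
  have : IsNoetherianRing A := isNoetherian_of_tower R inferInstance
  have : Module.Finite A N := by
    obtain ⟨k, s, hs⟩ := Module.Finite.exists_fin (R := C) (M := N)
    refine ⟨Submodule.fg_def.2 ⟨Set.range s, Set.finite_range s, ?_⟩⟩
    rw [eq_top_iff]
    intro n _
    obtain ⟨c, rfl⟩ := (Submodule.mem_span_range_iff_exists_fun C).1 (hs ▸ trivial :
      n ∈ Submodule.span C (Set.range s))
    choose a ha using fun j => hπ (c j)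
    refine Submodule.sum_mem _ fun j _ => ?_
    rw [← ha, ← hsmul]
    exact Submodule.smul_mem _ _ (Submodule.subset_span ⟨j, rfl⟩)
  obtain ⟨b, d, ε, hε, hε₀, hd⟩ := exists_resolution_mod (A := A) I N
  have hεI : ∀ x ∈ (I • ⊤ : Submodule R (Fin (b 0) → A)), ε x = 0 := by
    intro x hx
    induction hx using Submodule.smul_induction_on' with
    | smul r hr y _ =>
      rw [← algebraMap_smul A r y, map_smul, hsmul, (hπI _).2, zero_smul]
      rw [Algebra.algebraMap_eq_smul_one]
      exact Submodule.smul_mem_smul hr trivial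
    | add x _ y _ hx hy => rw [map_add, hx, hy, add_zero]
  let toSemi {k : ℕ} (f : (Fin k → A) →ₗ[A] N) : (Fin k → A) →ₛₗ[π] N :=
    { toFun := f
      map_add' := map_add f
      map_smul' := map_smul f }
  have hH := exists_homotopy hε hε₀ hεI hd fun f hf => by
    obtain ⟨g, hg⟩ := exists_coboundary_mod hπ hπI N hExt d (toSemi ε) hε hε₀ hd (toSemi f) hf
    exact ⟨{ toFun := g, map_add' := map_add g, map_smul' := g.map_smulₛₗ }, hg⟩
  obtain ⟨D, hDd, hDD⟩ := exists_complex hI (fun i x => (hd i _).2 ⟨x, rfl⟩)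
    fun {n} hn D => exists_improvement hA hH hn D
  have hD : ∀ i x, D i x ∈ (I • ⊤ : Submodule R (Fin (b i) → A)) →
      ∃ y, x - D (i + 1) y ∈ (I • ⊤ : Submodule R (Fin (b (i + 1)) → A)) := by
    intro i x hx
    obtain ⟨y, rfl⟩ := (hd i x).1 (by simpa using Submodule.sub_mem _ hx (hDd i x))
    refine ⟨y, ?_⟩
    rw [← neg_mem_iff, neg_sub]
    exact hDd _ _
  refine ⟨b, D, toSemi ε, hε, fun x => ⟨fun hx => ?_, ?_⟩, hDD, exact_of_exact_mod hI hA hDD hD,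
    hD⟩
  · obtain ⟨y, rfl⟩ := (hε₀ x).1 hx
    refine ⟨y, ?_⟩
    rw [← neg_mem_iff, neg_sub]
    exact hDd _ _
  · rintro ⟨y, hy⟩
    have h1 := Submodule.add_mem _ hy (hDd 0 y)
    rw [sub_add_sub_cancel] at h1
    have h2 := hεI _ h1
    rw [map_sub, (hε₀ _).2 ⟨y, rfl⟩, sub_zero] at h2
    exact h2

/-! ### The exact sequence as a projective resolution. -/

section ProjectiveResolution

variable {A : Type u} [Ring A] {b : ℕ → ℕ}
  (D : ∀ i, (Fin (b (i + 1)) → A) →ₗ[A] (Fin (b i) → A)) (hDD : ∀ i x, D i (D (i + 1) x) = 0)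

/-- The chain complex of free modules given by a sequence of maps. -/
noncomputable def freeComplex : ChainComplex (ModuleCat.{u} A) ℕ :=
  ChainComplex.of (fun i => ModuleCat.of A (Fin (b i) → A)) (fun i => ModuleCat.ofHom (D i))
    fun i => ModuleCat.hom_ext (LinearMap.ext (hDD i))

theorem freeComplex_d (i : ℕ) : (freeComplex D hDD).d (i + 1) i = ModuleCat.ofHom (D i) :=
  ChainComplex.of_d (fun i => ModuleCat.of A (Fin (b i) → A)) (fun i => ModuleCat.ofHom (D i)) i

theorem freeComplex_exactAt_succ (hD : ∀ i x, D i x = 0 → ∃ y, D (i + 1) y = x) (n : ℕ) :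
    (freeComplex D hDD).ExactAt (n + 1) := by
  rw [HomologicalComplex.exactAt_iff' _ (n + 1 + 1) (n + 1) n (by simp) (by simp),
    ShortComplex.moduleCat_exact_iff]
  simp only [HomologicalComplex.sc', HomologicalComplex.shortComplexFunctor', freeComplex_d]
  exact hD n

/-- The augmentation of `freeComplex` to the cokernel of the first map. -/
noncomputable def freeAugmentation : freeComplex D hDD ⟶ (ChainComplex.single₀ _).obj
    (ModuleCat.of A ((Fin (b 0) → A) ⧸ LinearMap.range (D 0))) :=
  (ChainComplex.toSingle₀Equiv _ _).symm
    ⟨ModuleCat.ofHom (LinearMap.range (D 0)).mkQ, by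
      rw [freeComplex_d]
      exact ModuleCat.hom_ext (LinearMap.ext fun x =>
        (Submodule.Quotient.mk_eq_zero _).2 (LinearMap.mem_range_self _ x))⟩

theorem freeAugmentation_f_zero :
    (freeAugmentation D hDD).f 0 = ModuleCat.ofHom (LinearMap.range (D 0)).mkQ :=
  ChainComplex.toSingle₀Equiv_symm_apply_f_zero _ _

/-- The cokernel of the first map is resolved by an exact sequence of free modules. -/
noncomputable def freeResolution (hD : ∀ i x, D i x = 0 → ∃ y, D (i + 1) y = x) :
    ProjectiveResolution (ModuleCat.of A ((Fin (b 0) → A) ⧸ LinearMap.range (D 0))) where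
  complex := freeComplex D hDD
  projective i := (IsProjective.iff_projective (R := A) (Fin (b i) → A)).1 inferInstance
  π := freeAugmentation D hDD
  quasiIso := ⟨fun n => by
    cases n
    · rw [ChainComplex.quasiIsoAt₀_iff, ShortComplex.quasiIso_iff_of_zeros']
      · let S := ShortComplex.mk (ModuleCat.ofHom (D 0))
          (ModuleCat.ofHom (LinearMap.range (D 0)).mkQ) 
          (ModuleCat.hom_ext (LinearMap.ext fun x =>
            (Submodule.Quotient.mk_eq_zero _).2 (LinearMap.mem_range_self _ x)))
        have hS : S.Exact ∧ Epi S.g := by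
          constructor
          · rw [ShortComplex.moduleCat_exact_iff]
            intro x hx
            exact (Submodule.Quotient.mk_eq_zero _).1 hx
          · exact (ModuleCat.epi_iff_surjective _).2 (Submodule.mkQ_surjective _)
        refine (ShortComplex.exact_and_epi_g_iff_of_iso ?_).2 hS
        exact ShortComplex.isoMk (Iso.refl _) (Iso.refl _) (Iso.refl _)
          ((Category.id_comp _).trans
            ((freeComplex_d D hDD 0).symm.trans (Category.comp_id _).symm))
          ((Category.id_comp _).trans ((freeAugmentation_f_zero D hDD).symm.trans
            (Category.comp_id ((freeAugmentation D hDD).f 0)).symm))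
      all_goals rfl
    · rw [quasiIsoAt_iff_exactAt']
      · exact freeComplex_exactAt_succ D hDD hD _
      · apply ChainComplex.exactAt_succ_single_obj⟩

end ProjectiveResolution

/-! ### The functor `- ⊗ Λ / 𝔞Λ` as reduction modulo `𝔞`. -/

section Reduction

variable {R : Type u} [CommRing R] (𝔞 : Ideal R) (Λ : Type u) [Ring Λ] [Algebra R Λ]

theorem mem_extendedIdeal_iff (a : Λ) : a ∈ extendedIdeal 𝔞 Λ ↔ a ∈ (𝔞 • ⊤ : Submodule R Λ) := by
  constructor
  · intro ha
    induction ha using Submodule.span_induction with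
    | mem a ha =>
      obtain ⟨r, hr, rfl⟩ := ha
      rw [Algebra.algebraMap_eq_smul_one]
      exact Submodule.smul_mem_smul hr trivial
    | zero => exact Submodule.zero_mem _
    | add a c _ _ ha hc => exact Submodule.add_mem _ ha hc
    | smul c a _ ha => exact smul_mem_smul_top 𝔞 c ha
  · intro ha
    induction ha using Submodule.smul_induction_on' with
    | smul r hr y _ =>
      rw [Algebra.smul_def, Algebra.commutes]
      exact Ideal.mul_mem_left _ _ (Ideal.mem_map_of_mem _ hr)
    | add a _ c _ ha hc => exact Ideal.add_mem _ ha hc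

/-- The projection `Λᵐᵒᵖ → (Λ / 𝔞Λ)ᵐᵒᵖ`. -/
def redOp : Λᵐᵒᵖ →+* (QuotAlgebra 𝔞 Λ)ᵐᵒᵖ := (Ideal.Quotient.mk (extendedIdeal 𝔞 Λ)).op

theorem redOp_surjective : Function.Surjective (redOp 𝔞 Λ) := by
  intro x
  obtain ⟨a, ha⟩ := Ideal.Quotient.mk_surjective x.unop
  exact ⟨op a, unop_injective ha⟩

theorem redOp_eq_zero_iff (a : Λᵐᵒᵖ) :
    redOp 𝔞 Λ a = 0 ↔ a ∈ (𝔞 • ⊤ : Submodule R Λᵐᵒᵖ) := by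
  have h1 : redOp 𝔞 Λ a = 0 ↔ a.unop ∈ extendedIdeal 𝔞 Λ := by
    rw [← Ideal.Quotient.eq_zero_iff_mem, ← op_eq_zero_iff (Ideal.Quotient.mk _ _)]
    rfl
  rw [h1, mem_extendedIdeal_iff]
  constructor
  · exact fun h => map_mem_smul_top 𝔞 (opLinearEquiv R : Λ ≃ₗ[R] Λᵐᵒᵖ).toLinearMap h
  · exact fun h => map_mem_smul_top 𝔞 (opLinearEquiv R : Λ ≃ₗ[R] Λᵐᵒᵖ).symm.toLinearMap h

variable {Λ} {M : Type u} [AddCommGroup M] [Module Λᵐᵒᵖ M]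

/-- The map `m ↦ 1 ⊗ m` to the reduction of `M` modulo `𝔞`. -/
def oneTmul : M →+ BalancedTensor Λ (QuotAlgebra 𝔞 Λ) (QuotAlgebra 𝔞 Λ) M where
  toFun m := Submodule.Quotient.mk (1 ⊗ₜ[ℤ] m)
  map_zero' := by rw [TensorProduct.tmul_zero, Submodule.Quotient.mk_zero]
  map_add' x y := by rw [TensorProduct.tmul_add, Submodule.Quotient.mk_add]

theorem mk_tmul_eq_oneTmul (a : Λ) (m : M) :
    (Submodule.Quotient.mk (Ideal.Quotient.mk (extendedIdeal 𝔞 Λ) a ⊗ₜ[ℤ] m) :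
      BalancedTensor Λ (QuotAlgebra 𝔞 Λ) (QuotAlgebra 𝔞 Λ) M) = oneTmul 𝔞 (op a • m) := by
  refine (Submodule.Quotient.eq _).2 (Submodule.subset_span ⟨a, 1, m, ?_⟩)
  congr 2
  change Ideal.Quotient.mk _ a = Ideal.Quotient.mk _ (a * 1)
  rw [mul_one]

theorem oneTmul_surjective : Function.Surjective (oneTmul (Λ := Λ) (M := M) 𝔞) := by
  intro t
  obtain ⟨t, rfl⟩ := Submodule.Quotient.mk_surjective _ t
  induction t using TensorProduct.induction_on with
  | zero => exact ⟨0, by rw [map_zero, Submodule.Quotient.mk_zero]⟩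
  | tmul c m =>
    obtain ⟨a, rfl⟩ := Ideal.Quotient.mk_surjective c
    exact ⟨_, (mk_tmul_eq_oneTmul 𝔞 a m).symm⟩
  | add x y hx hy =>
    obtain ⟨m, hm⟩ := hx
    obtain ⟨m', hm'⟩ := hy
    exact ⟨m + m', by rw [map_add, hm, hm', Submodule.Quotient.mk_add]⟩

theorem oneTmul_eq_zero [Module R M] [IsScalarTower R Λᵐᵒᵖ M] {m : M}
    (hm : m ∈ (𝔞 • ⊤ : Submodule R M)) : oneTmul (Λ := Λ) 𝔞 m = 0 := by
  induction hm using Submodule.smul_induction_on' with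
  | smul r hr y _ =>
    rw [← algebraMap_smul Λᵐᵒᵖ r y, MulOpposite.algebraMap_apply, ← mk_tmul_eq_oneTmul,
      Ideal.Quotient.eq_zero_iff_mem.2 (Ideal.mem_map_of_mem _ hr), TensorProduct.zero_tmul,
      Submodule.Quotient.mk_zero]
  | add a _ c _ ha hc => rw [map_add, ha, hc, add_zero]

/-- The map `c ⊗ m ↦ f m * c`, before passing to the quotient. -/
def preLiftRed {P : Type u} [AddCommGroup P] [Module (QuotAlgebra 𝔞 Λ)ᵐᵒᵖ P]
    (f : M →ₛₗ[redOp 𝔞 Λ] P) : QuotAlgebra 𝔞 Λ ⊗[ℤ] M →ₗ[(QuotAlgebra 𝔞 Λ)ᵐᵒᵖ] P where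
  toFun := TensorProduct.liftAddHom
    (AddMonoidHom.mk' (fun c => (DistribSMul.toAddMonoidHom P (op c)).comp f.toAddMonoidHom)
      fun c c' => by
        ext m
        simp [add_smul])
    fun n c m => by
      change op (n • c) • f m = op c • f (n • m)
      rw [map_zsmul, op_smul, smul_assoc, smul_comm]
  map_add' := map_add _
  map_smul' c t := by
    induction t using TensorProduct.induction_on with
    | zero => simp
    | tmul x m =>
      rw [TensorProduct.smul_tmul']
      change op (x * c.unop) • f m = c • op x • f m
      rw [op_mul, op_unop, mul_smul]
    | add x y hx hy => rw [smul_add, map_add, hx, hy, map_add, smul_add]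

theorem preLiftRed_tmul {P : Type u} [AddCommGroup P] [Module (QuotAlgebra 𝔞 Λ)ᵐᵒᵖ P]
    (f : M →ₛₗ[redOp 𝔞 Λ] P) (c : QuotAlgebra 𝔞 Λ) (m : M) :
    preLiftRed 𝔞 f (c ⊗ₜ[ℤ] m) = op c • f m := rfl

theorem balancedRel_le_ker {P : Type u} [AddCommGroup P] [Module (QuotAlgebra 𝔞 Λ)ᵐᵒᵖ P]
    (f : M →ₛₗ[redOp 𝔞 Λ] P) :
    balancedRel Λ (QuotAlgebra 𝔞 Λ) (QuotAlgebra 𝔞 Λ) M ≤ LinearMap.ker (preLiftRed 𝔞 f) := by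
  rw [balancedRel, Submodule.span_le]
  rintro _ ⟨a, x, m, rfl⟩
  rw [SetLike.mem_coe, LinearMap.mem_ker, map_sub, sub_eq_zero, preLiftRed_tmul, preLiftRed_tmul,
    f.map_smulₛₗ, smul_smul]
  rfl

/-- The map from the reduction of `M` modulo `𝔞` induced by a semilinear map from `M`. -/
def liftRed {P : Type u} [AddCommGroup P] [Module (QuotAlgebra 𝔞 Λ)ᵐᵒᵖ P]
    (f : M →ₛₗ[redOp 𝔞 Λ] P) :
    BalancedTensor Λ (QuotAlgebra 𝔞 Λ) (QuotAlgebra 𝔞 Λ) M →ₗ[(QuotAlgebra 𝔞 Λ)ᵐᵒᵖ] P :=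
  Submodule.liftQ _ (preLiftRed 𝔞 f) (balancedRel_le_ker 𝔞 f)

theorem liftRed_oneTmul {P : Type u} [AddCommGroup P] [Module (QuotAlgebra 𝔞 Λ)ᵐᵒᵖ P]
    (f : M →ₛₗ[redOp 𝔞 Λ] P) (m : M) : liftRed 𝔞 f (oneTmul 𝔞 m) = f m :=
  one_smul _ _

/-- The reduction of `M` modulo `𝔞` is determined by a semilinear surjection with
kernel `𝔞 M`. -/
theorem nonempty_iso_of_ker_eq {P : ModuleCat.{u} (QuotAlgebra 𝔞 Λ)ᵐᵒᵖ} {M : ModuleCat.{u} Λᵐᵒᵖ}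
    (f : M →ₛₗ[redOp 𝔞 Λ] P) (hf : Function.Surjective f)
    (h : ∀ m : M, f m = 0 → oneTmul (Λ := Λ) 𝔞 m = 0) :
    Nonempty ((tensorFunctor Λ (QuotAlgebra 𝔞 Λ) (QuotAlgebra 𝔞 Λ)).obj M ≅ P) := by
  refine ⟨(LinearEquiv.ofBijective (liftRed 𝔞 f) ⟨?_, fun p => ?_⟩).toModuleIso⟩
  · rw [injective_iff_map_eq_zero]
    intro t ht
    obtain ⟨m, rfl⟩ := oneTmul_surjective 𝔞 t
    rw [liftRed_oneTmul] at ht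
    exact h m ht
  · obtain ⟨m, rfl⟩ := hf p
    exact ⟨_, liftRed_oneTmul 𝔞 f m⟩

/-- Elements of the reduced complex have the form `1 ⊗ x`, and on free modules `piRed` shows that `1
⊗ x = 0` forces `x` into the multiples of `𝔞`. Exactness of the reduced complex is then `hmod`. -/
theorem isZero_tor_of_exact_mod {b : ℕ → ℕ}
    (D : ∀ i, (Fin (b (i + 1)) → Λᵐᵒᵖ) →ₗ[Λᵐᵒᵖ] (Fin (b i) → Λᵐᵒᵖ))
    (hDD : ∀ i x, D i (D (i + 1) x) = 0) (hD : ∀ i x, D i x = 0 → ∃ y, D (i + 1) y = x)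
    (hmod : ∀ i x, D i x ∈ (𝔞 • ⊤ : Submodule R (Fin (b i) → Λᵐᵒᵖ)) →
      ∃ y, x - D (i + 1) y ∈ (𝔞 • ⊤ : Submodule R (Fin (b (i + 1)) → Λᵐᵒᵖ)))
    (n : ℕ) (hn : 0 < n) :
    IsZero ((torFunctor Λ (QuotAlgebra 𝔞 Λ) (QuotAlgebra 𝔞 Λ) n).obj
      (ModuleCat.of Λᵐᵒᵖ ((Fin (b 0) → Λᵐᵒᵖ) ⧸ LinearMap.range (D 0)))) := by
  obtain ⟨n, rfl⟩ := Nat.exists_eq_succ_of_ne_zero hn.ne'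
  refine IsZero.of_iso ?_ ((freeResolution D hDD hD).isoLeftDerivedObj _ (n + 1))
  rw [HomologicalComplex.homologyFunctor_obj, ← HomologicalComplex.exactAt_iff_isZero_homology,
    HomologicalComplex.exactAt_iff' _ (n + 1 + 1) (n + 1) n (by simp) (by simp),
    ShortComplex.moduleCat_exact_iff]
  simp only [HomologicalComplex.sc', HomologicalComplex.shortComplexFunctor', freeResolution,
    Functor.mapHomologicalComplex_obj_d, freeComplex_d]
  intro (t : BalancedTensor Λ (QuotAlgebra 𝔞 Λ) (QuotAlgebra 𝔞 Λ) (Fin (b (n + 1)) → Λᵐᵒᵖ))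
    (ht : balancedMap Λ (QuotAlgebra 𝔞 Λ) (QuotAlgebra 𝔞 Λ) (D n) t = 0)
  obtain ⟨x, rfl⟩ := oneTmul_surjective 𝔞 t
  have h1 : oneTmul (Λ := Λ) 𝔞 (D n x) = 0 := ht
  have h2 := congrArg (liftRed 𝔞 (piRed (redOp 𝔞 Λ) (b n))) h1
  rw [liftRed_oneTmul, map_zero, piRed_eq_zero_iff (redOp_eq_zero_iff 𝔞 Λ)] at h2
  obtain ⟨y, hy⟩ := hmod n x h2
  refine ⟨oneTmul (Λ := Λ) 𝔞 y, ?_⟩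
  have h3 := oneTmul_eq_zero (Λ := Λ) 𝔞 hy
  rw [map_sub, sub_eq_zero] at h3
  exact h3.symm

end Reduction
end AbelianLift

theorem mainTheorem12 {R Λ : Type u} [CommRing R] [IsNoetherianRing R] [IsLocalRing R]
    [IsAdicComplete (IsLocalRing.maximalIdeal R) R]
    [Ring Λ] [Algebra R Λ] [Module.Finite R Λ]
    (𝔞 : Ideal R) (h𝔞 : 𝔞 ≠ ⊤)
    (hTor : ∀ n : ℕ, 0 < n →
      IsZero (((Tor (ModuleCat.{u} R) n).obj (ModuleCat.of R Λ)).obj (ModuleCat.of R (R ⧸ 𝔞))))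
    (hFlat : AbelianLift.IsNormallyFlat 𝔞)
    (N : ModuleCat.{u} (AbelianLift.QuotAlgebra 𝔞 Λ)ᵐᵒᵖ)
    (hN : Module.Finite (AbelianLift.QuotAlgebra 𝔞 Λ)ᵐᵒᵖ N)
    (hExt : Subsingleton (Abelian.Ext.{u} N N 2)) :
    ∃ M : ModuleCat.{u} Λᵐᵒᵖ, Module.Finite Λᵐᵒᵖ M ∧ AbelianLift.LiftsTo 𝔞 Λ N M := by
  open AbelianLift in
  have hgr : HasGradedBasis 𝔞 Λ := by
    refine hasGradedBasis_of_injective (fun n => ?_)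
      (idealTensorMap_injective_of_isZero_tor h𝔞 (hTor 1 one_pos))
    rcases n.eq_zero_or_pos with rfl | hn
    · exact ⟨1, exists_gradedBasis_zero⟩
    · have := hFlat n hn
      exact exists_gradedBasis h𝔞 n
  have : Module.Finite R Λᵐᵒᵖ := Module.Finite.equiv (opLinearEquiv R)
  obtain ⟨b, D, ε, hε, hε₀, hDD, hD, hmod⟩ := exists_resolution_lift h𝔞
    (hgr.of_equiv (opLinearEquiv R)) (redOp_surjective 𝔞 Λ) (redOp_eq_zero_iff 𝔞 Λ) N hExt
  refine ⟨ModuleCat.of Λᵐᵒᵖ ((Fin (b 0) → Λᵐᵒᵖ) ⧸ LinearMap.range (D 0)), inferInstance, ?_,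
    isZero_tor_of_exact_mod 𝔞 D hDD hD hmod⟩
  have hker : LinearMap.range (D 0) ≤ LinearMap.ker ε := by
    rintro _ ⟨y, rfl⟩
    exact (hε₀ _).2 ⟨y, by rw [sub_self]; exact Submodule.zero_mem _⟩
  -- The kernel of `ε` is the range of `D 0` plus the multiples of `𝔞`, so the induced map from the
  -- cokernel to `N` has kernel `𝔞 M`.
  refine nonempty_iso_of_ker_eq 𝔞 (M := ModuleCat.of Λᵐᵒᵖ _)
    ((LinearMap.range (D 0)).liftQ ε hker) (fun n => ?_) fun m hm => ?_
  · obtain ⟨x, rfl⟩ := hε n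
    exact ⟨Submodule.Quotient.mk x, rfl⟩
  · obtain ⟨x, rfl⟩ := Submodule.Quotient.mk_surjective _ m
    obtain ⟨y, hy⟩ := (hε₀ x).1 hm
    have h := oneTmul_eq_zero (Λ := Λ) 𝔞
      (map_mem_smul_top 𝔞 (LinearMap.range (D 0)).mkQ hy)
    rw [map_sub, Submodule.mkQ_apply, Submodule.mkQ_apply,
      (Submodule.Quotient.mk_eq_zero _).2 (LinearMap.mem_range_self _ y), sub_zero] at h
    exact h
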